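/- Let $n$ be an integer with $43 \le n \le 1{,}345{,}000$. An $n$-qubit Clifford operation is a unitary operator on $(\mathbb{C}^2)^{\otimes n}$ computed by some circuit on $n$ qubits over the single-qubit Hadamard gate $H=\frac{1}{\sqrt2}\begin{pmatrix}1&1\\1&-1\end{pmatrix}$, the single-qubit Phase gate $P=\begin{pmatrix}1&0\\0&i\end{pmatrix}$ and the two-qubit CNOT gate (applied to arbitrary qubits). The two-qubit depth of a circuit is the least number of time steps in which it can be executed, when two-qubit gates acting on disjoint pairs of qubits may share a time step and single-qubit gates are not counted. Then every $n$-qubit Clifford operation can be computed exactly, without ancillary qubits, by a circuit over the gates $H$, $P$, CNOT and CZ (where $\mathrm{CZ}=\mathrm{diag}(1,1,1,-1)$) of two-qubit depth at most $$\left\lfloor 2n + 2.9487\,(\log_2 n)^2 + 8.4909\,\log_2 n - 44.4798 \right\rfloor .$$ -/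

import Mathlib

namespace CliffordDepth

/-- The computational basis of `n` qubits: bit strings of length `n`. -/
abbrev Basis (n : ℕ) : Type := Fin n → Fin 2

/-- The single-qubit Hadamard matrix. -/
noncomputable def hadamardMatrix : Matrix (Fin 2) (Fin 2) ℂ :=
  ((Real.sqrt 2 : ℝ) : ℂ)⁻¹ • !![1, 1; 1, -1]

/-- The single-qubit Phase matrix. -/
def phaseMatrix : Matrix (Fin 2) (Fin 2) ℂ :=
  !![1, 0; 0, Complex.I]

/-- The two-qubit CNOT matrix (first qubit: control, second qubit: target), in the ordered basis
`00, 01, 10, 11`; the bijection `finProdFinEquiv` sends `(a, b)` to `2 * a + b`. -/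
def cnotMatrix : Matrix (Fin 2 × Fin 2) (Fin 2 × Fin 2) ℂ :=
  Matrix.submatrix
    !![1, 0, 0, 0;
       0, 1, 0, 0;
       0, 0, 0, 1;
       0, 0, 1, 0]
    finProdFinEquiv finProdFinEquiv

/-- The two-qubit CZ matrix, in the ordered basis `00, 01, 10, 11`. -/
def czMatrix : Matrix (Fin 2 × Fin 2) (Fin 2 × Fin 2) ℂ :=
  Matrix.submatrix
    !![1, 0, 0, 0;
       0, 1, 0, 0;
       0, 0, 1, 0;
       0, 0, 0, -1]
    finProdFinEquiv finProdFinEquiv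

/-- The operator on `n` qubits that acts as `U` on qubit `i` and as the identity elsewhere. -/
def onQubit {n : ℕ} (U : Matrix (Fin 2) (Fin 2) ℂ) (i : Fin n) :
    Matrix (Basis n) (Basis n) ℂ :=
  Matrix.of fun x y => if ∀ k, k ≠ i → x k = y k then U (x i) (y i) else 0

/-- The operator on `n` qubits that acts as `U` on the ordered pair of (distinct) qubits `i, j`
and as the identity elsewhere. -/
def onQubitPair {n : ℕ} (U : Matrix (Fin 2 × Fin 2) (Fin 2 × Fin 2) ℂ) (i j : Fin n) :
    Matrix (Basis n) (Basis n) ℂ :=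
  Matrix.of fun x y =>
    if ∀ k, k ≠ i → k ≠ j → x k = y k then U (x i, x j) (y i, y j) else 0

/-- The gates on `n` qubits: Hadamard, Phase, CNOT (control `i`, target `j`) and CZ. -/
inductive Gate (n : ℕ) : Type
  | H (i : Fin n) : Gate n
  | P (i : Fin n) : Gate n
  | CNOT (i j : Fin n) (hij : i ≠ j) : Gate n
  | CZ (i j : Fin n) (hij : i ≠ j) : Gate n

namespace Gate

/-- The `2 ^ n × 2 ^ n` matrix of a gate. -/
noncomputable def toMatrix {n : ℕ} : Gate n → Matrix (Basis n) (Basis n) ℂ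
  | H i => onQubit hadamardMatrix i
  | P i => onQubit phaseMatrix i
  | CNOT i j _ => onQubitPair cnotMatrix i j
  | CZ i j _ => onQubitPair czMatrix i j

/-- The gate belongs to the library `{H, P, CNOT}` that defines the Clifford operations. -/
def IsHPCNOT {n : ℕ} : Gate n → Prop
  | H _ => True
  | P _ => True
  | CNOT _ _ _ => True
  | CZ _ _ _ => False

/-- Scheduling of a gate: `t k` is the number of the last time step in which qubit `k` has been
used by a two-qubit gate so far. A two-qubit gate on `i, j` is executed in the first time step in
which both of its qubits are free; single-qubit gates take no time. -/
def schedule {n : ℕ} (t : Fin n → ℕ) : Gate n → (Fin n → ℕ)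
  | H _ => t
  | P _ => t
  | CNOT i j _ => fun k => if k = i ∨ k = j then max (t i) (t j) + 1 else t k
  | CZ i j _ => fun k => if k = i ∨ k = j then max (t i) (t j) + 1 else t k

end Gate

/-- A circuit on `n` qubits (without ancillary qubits) over `{H, P, CNOT, CZ}`: the list of its
gates, the first one being applied first. -/
abbrev Circuit (n : ℕ) : Type := List (Gate n)

namespace Circuit

/-- The operator computed by a circuit. -/
noncomputable def toMatrix {n : ℕ} : Circuit n → Matrix (Basis n) (Basis n) ℂ
  | [] => 1
  | g :: c => toMatrix c * g.toMatrix

/-- The two-qubit depth of a circuit: the number of time steps needed to execute it when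
two-qubit gates on disjoint pairs of qubits can be executed in the same time step and
single-qubit gates are not counted. -/
def depth {n : ℕ} (c : Circuit n) : ℕ :=
  Finset.univ.sup (List.foldl Gate.schedule (fun _ : Fin n => 0) c)

end Circuit

/-- The `n`-qubit Clifford operations: the operators computed by the circuits over
`{H, P, CNOT}`. -/
def IsClifford {n : ℕ} (U : Matrix (Basis n) (Basis n) ℂ) : Prop :=
  ∃ c : Circuit n, (∀ g ∈ c, g.IsHPCNOT) ∧ Circuit.toMatrix c = U

end CliffordDepth

namespace CliffordDepth

open Matrix Finset

/-! ### Operators on bit strings over `ZMod 2` -/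

/-! The entries of a Clifford operation, apart from a layer of Hadamard gates, form a quadratic
phase in the row and column bits (`exists_hasForm`). Such a phase splits as `ω^k · A(x) · (-1)^(x ·
B y) · A'(y)`, where `A` and `A'` come from P and CZ gates (`exists_factorization`). Invertibility
of the operator forces `B` to be invertible, and an LUP decomposition of `B⁻¹` turns the kernel
`(-1)^(x · B y)` into a permutation, a triangular linear map, Hadamard gates on all qubits and
another triangular linear map (`exists_kernel_factorization`). Hence two CZ layers, two triangular
maps and one permutation suffice; Hadamard and Phase gates and the scalar `ω^k` cost nothing.

A CZ layer is a graph, and its depth is an edge chromatic number. Complementing the graph along a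
vertex cut costs only `O(log n)`: compute the parities of both sides by CNOT trees, apply one CZ,
uncompute. A suitable cut halves the maximum degree relative to the complete graph
(`exists_switching`), so Vizing's theorem gives depth `n/2 + O(log n)` (`Impl.czPhase_univ`).

For bipartite graphs with parts of size `m` the same method gives `m/2 + O(log m)`. A triangular
matrix splits into two diagonal blocks, run in parallel, and one off-diagonal block, which is a
bipartite CZ layer conjugated by Hadamard gates. So the depth satisfies `T(n) = T(n/2) + n/4 + O(log
n)`, that is, `n/2` plus a term quadratic in `log n` (`triangularBound_pow`). A permutation is a
product of two involutions and takes depth 6.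

Altogether the two CZ layers and the two triangular maps contribute `n` each. The explicit constants
follow by direct estimates, with refined triangular bounds for some small `n`. -/

/-- Bit strings, as vectors over the field with two elements. -/
abbrev Bits (n : ℕ) : Type := Fin n → ZMod 2

/-- Matrices on `n` qubits, indexed by vectors over the field with two elements. -/
abbrev Op (n : ℕ) : Type := Matrix (Bits n) (Bits n) ℂ

theorem zmod_two_cases (a : ZMod 2) : a = 0 ∨ a = 1 := by
  revert a; decide

theorem zmod_two_add_self (a : ZMod 2) : a + a = 0 := CharTwo.add_self_eq_zero a

theorem zmod_two_mul_self (a : ZMod 2) : a * a = a := by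
  revert a; decide

theorem sum_zmod_two {M : Type*} [AddCommMonoid M] (f : ZMod 2 → M) : ∑ a, f a = f 0 + f 1 :=
  Fin.sum_univ_two f

/-- The nontrivial additive character of `ZMod 2`. -/
def sgn (a : ZMod 2) : ℂ := if a = 0 then 1 else -1

@[simp] theorem sgn_zero : sgn 0 = 1 := by simp [sgn]

@[simp] theorem sgn_one : sgn 1 = -1 := by simp [sgn]

theorem sgn_add (a b : ZMod 2) : sgn (a + b) = sgn a * sgn b := by
  rcases zmod_two_cases a with rfl | rfl <;> rcases zmod_two_cases b with rfl | rfl <;>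
    simp [zmod_two_add_self]

theorem sgn_mul_self (a : ZMod 2) : sgn a * sgn a = 1 := by
  rw [← sgn_add, zmod_two_add_self, sgn_zero]

theorem sgn_sum {ι : Type*} (s : Finset ι) (f : ι → ZMod 2) :
    sgn (∑ i ∈ s, f i) = ∏ i ∈ s, sgn (f i) := by
  classical
  induction s using Finset.induction_on with
  | empty => simp
  | insert a s ha ih => rw [sum_insert ha, prod_insert ha, sgn_add, ih]

/-- The function `0 ↦ 1`, `1 ↦ i`. -/
noncomputable def iota (a : ZMod 2) : ℂ := if a = 0 then 1 else Complex.I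

@[simp] theorem iota_zero : iota 0 = 1 := by simp [iota]

@[simp] theorem iota_one : iota 1 = Complex.I := by simp [iota]

theorem iota_add (a b : ZMod 2) : iota (a + b) = iota a * iota b * sgn (a * b) := by
  rcases zmod_two_cases a with rfl | rfl <;> rcases zmod_two_cases b with rfl | rfl <;>
    simp [zmod_two_add_self]

theorem iota_sq (a : ZMod 2) : iota a * iota a = sgn a := by
  rcases zmod_two_cases a with rfl | rfl <;> simp

variable {n : ℕ}

/-- The diagonal operator with entries `f`. -/
def dg (f : Bits n → ℂ) : Op n := Matrix.diagonal f

/-- The operator `|y⟩ ↦ |g y⟩`. -/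
def fn (g : Bits n → Bits n) : Op n := Matrix.of fun x y => if x = g y then 1 else 0

/-- The tensor product of the single-qubit operators `M k`. -/
def tens (M : Fin n → Matrix (ZMod 2) (ZMod 2) ℂ) : Op n :=
  Matrix.of fun x y => ∏ k, M k (x k) (y k)

theorem dg_mul_dg (f g : Bits n → ℂ) : dg f * dg g = dg fun x => f x * g x :=
  Matrix.diagonal_mul_diagonal f g

theorem dg_one : dg (fun _ : Bits n => (1 : ℂ)) = 1 := Matrix.diagonal_one

theorem fn_id : fn (fun x : Bits n => x) = 1 := by
  ext x y; simp [fn, Matrix.one_apply]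

theorem fn_mul_fn (g h : Bits n → Bits n) : fn g * fn h = fn fun x => g (h x) := by
  ext x y
  simp [fn, Matrix.mul_apply]

theorem fn_dg_fn {g g' : Bits n → Bits n} (hg : ∀ x, g' (g x) = x) (f : Bits n → ℂ) :
    fn g' * dg f * fn g = dg fun x => f (g x) := by
  ext x y
  simp only [fn, dg, Matrix.mul_apply, Matrix.of_apply, mul_ite, mul_one,
    mul_zero, Finset.sum_ite_eq', Finset.mem_univ, if_true, hg, Matrix.diagonal_apply]
  by_cases h : x = y
  · simp [h]
  · simp [h]

theorem tens_mul_tens (M N : Fin n → Matrix (ZMod 2) (ZMod 2) ℂ) :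
    tens M * tens N = tens fun k => M k * N k := by
  ext x y
  simp only [tens, Matrix.mul_apply, Matrix.of_apply, Finset.prod_univ_sum,
    Fintype.piFinset_univ, Finset.prod_mul_distrib]

theorem tens_one : tens (fun _ : Fin n => (1 : Matrix (ZMod 2) (ZMod 2) ℂ)) = 1 := by
  ext x y
  by_cases h : x = y
  · subst h; simp [tens]
  · obtain ⟨k, hk⟩ := Function.ne_iff.1 h
    rw [Matrix.one_apply_ne h]
    exact Finset.prod_eq_zero (Finset.mem_univ k) (Matrix.one_apply_ne hk)

/-- The Hadamard matrix, indexed by `ZMod 2`. -/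
noncomputable def hm : Matrix (ZMod 2) (ZMod 2) ℂ :=
  Matrix.of fun a b => ((Real.sqrt 2 : ℝ) : ℂ)⁻¹ * sgn (a * b)

theorem sqrt_two_sq : ((Real.sqrt 2 : ℝ) : ℂ) * ((Real.sqrt 2 : ℝ) : ℂ) = 2 := by
  rw [← Complex.ofReal_mul, Real.mul_self_sqrt (by norm_num)]; norm_num

theorem sqrt_two_ne : ((Real.sqrt 2 : ℝ) : ℂ) ≠ 0 := by
  intro h; have := sqrt_two_sq; rw [h] at this; norm_num at this

theorem sqrt_two_inv_sq : ((Real.sqrt 2 : ℝ) : ℂ)⁻¹ * ((Real.sqrt 2 : ℝ) : ℂ)⁻¹ = 1 / 2 := by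
  rw [← mul_inv, sqrt_two_sq]; norm_num

theorem hm_mul_hm : hm * hm = 1 := by
  ext a b
  rw [Matrix.mul_apply, sum_zmod_two]
  have h := sqrt_two_inv_sq
  rcases zmod_two_cases a with rfl | rfl <;> rcases zmod_two_cases b with rfl | rfl <;>
    simp [hm] <;> linear_combination 2 * h

/-- The Hadamard gates on the qubits in `S`. -/
noncomputable def had (S : Finset (Fin n)) : Op n := tens fun k => if k ∈ S then hm else 1

theorem had_mul_had (S : Finset (Fin n)) : had S * had S = 1 := by
  rw [had, tens_mul_tens, ← tens_one]
  congr 1; funext k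
  split_ifs <;> simp [hm_mul_hm]

theorem had_union {S T : Finset (Fin n)} (h : Disjoint S T) : had S * had T = had (S ∪ T) := by
  rw [had, had, had, tens_mul_tens]
  congr 1; funext k
  by_cases h1 : k ∈ S
  · have h2 : k ∉ T := Finset.disjoint_left.1 h h1
    simp [h1, h2]
  · by_cases h2 : k ∈ T <;> simp [h1, h2]

theorem had_empty : had (∅ : Finset (Fin n)) = 1 := by
  simpa [had] using tens_one (n := n)

/-! ### Circuits -/

/-- The computational basis, seen as vectors over the field with two elements. -/
def bitsEquiv (n : ℕ) : Bits n ≃ Basis n := Equiv.refl (Basis n)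

/-- The operator of a gate, on vectors over the field with two elements. -/
noncomputable def gmat (g : Gate n) : Op n := g.toMatrix.submatrix (bitsEquiv n) (bitsEquiv n)

/-- The operator of a circuit, on vectors over the field with two elements. -/
noncomputable def cmat (c : Circuit n) : Op n :=
  (Circuit.toMatrix c).submatrix (bitsEquiv n) (bitsEquiv n)

theorem cmat_nil : cmat ([] : Circuit n) = 1 := by
  simp [cmat, Circuit.toMatrix]

theorem cmat_cons (g : Gate n) (c : Circuit n) : cmat (g :: c) = cmat c * gmat g := by
  simp [cmat, gmat, Circuit.toMatrix, Matrix.submatrix_mul_equiv]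

theorem cmat_append (c d : Circuit n) : cmat (c ++ d) = cmat d * cmat c := by
  induction c with
  | nil => simp [cmat_nil]
  | cons g c ih => rw [List.cons_append, cmat_cons, cmat_cons, ih, mul_assoc]

theorem cmat_singleton (g : Gate n) : cmat [g] = gmat g := by
  rw [cmat_cons, cmat_nil, one_mul]

theorem toMatrix_eq_of_cmat_eq {c d : Circuit n} (h : cmat c = cmat d) :
    Circuit.toMatrix c = Circuit.toMatrix d := by
  ext x y
  exact congrFun (congrFun h ((bitsEquiv n).symm x)) ((bitsEquiv n).symm y)

theorem gmat_H (i : Fin n) : gmat (Gate.H i) = had {i} := by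
  ext x y
  have e : gmat (Gate.H i) x y =
      if ∀ k, k ≠ i → x k = y k then hadamardMatrix (x i) (y i) else 0 := rfl
  rw [e, had, tens, Matrix.of_apply, ← Finset.mul_prod_erase _ _ (Finset.mem_univ i)]
  have e2 : hadamardMatrix (x i) (y i) = hm (x i) (y i) := by
    generalize x i = a
    generalize y i = b
    rcases zmod_two_cases a with rfl | rfl <;> rcases zmod_two_cases b with rfl | rfl
    · change hadamardMatrix 0 0 = _
      simp [hadamardMatrix, hm]
    · change hadamardMatrix 0 1 = _
      simp [hadamardMatrix, hm]
    · change hadamardMatrix 1 0 = _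
      simp [hadamardMatrix, hm]
    · change hadamardMatrix 1 1 = _
      simp [hadamardMatrix, hm]
  by_cases h : ∀ k, k ≠ i → x k = y k
  · rw [if_pos h, Finset.prod_eq_one, e2]
    · simp
    · intro k hk
      have hk' := (Finset.mem_erase.1 hk).1
      rw [if_neg (by simpa using hk'), h k hk', Matrix.one_apply_eq]
  · rw [if_neg h]
    push Not at h
    obtain ⟨k, hk, hne⟩ := h
    rw [Finset.prod_eq_zero (i := k), mul_zero]
    · simpa using hk
    · rw [if_neg (by simpa using hk), Matrix.one_apply_ne hne]

theorem gmat_P (i : Fin n) : gmat (Gate.P i) = dg fun x => iota (x i) := by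
  ext x y
  have e : gmat (Gate.P i) x y =
      if ∀ k, k ≠ i → x k = y k then phaseMatrix (x i) (y i) else 0 := rfl
  have e0 : ∀ a b : ZMod 2, phaseMatrix a b = if a = b then iota a else 0 := by
    intro a b
    rcases zmod_two_cases a with rfl | rfl <;> rcases zmod_two_cases b with rfl | rfl
    · change phaseMatrix 0 0 = _
      simp [phaseMatrix]
    · change phaseMatrix 0 1 = _
      simp [phaseMatrix]
    · change phaseMatrix 1 0 = _
      simp [phaseMatrix]
    · change phaseMatrix 1 1 = _
      simp [phaseMatrix]
  rw [e, e0, dg, Matrix.diagonal_apply]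
  by_cases hxy : x = y
  · simp [hxy]
  · rw [if_neg hxy]
    by_cases h : ∀ k, k ≠ i → x k = y k
    · rw [if_pos h, if_neg]
      intro hi
      apply hxy
      funext k
      by_cases hk : k = i
      · rw [hk, hi]
      · exact h k hk
    · rw [if_neg h]

theorem czMatrix_apply (a b c d : ZMod 2) :
    czMatrix (a, b) (c, d) = if a = c ∧ b = d then sgn (a * b) else 0 := by
  rcases zmod_two_cases a with rfl | rfl <;> rcases zmod_two_cases b with rfl | rfl <;>
  rcases zmod_two_cases c with rfl | rfl <;> rcases zmod_two_cases d with rfl | rfl <;>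
  simp [czMatrix, finProdFinEquiv] <;> rfl

theorem cnotMatrix_apply (a b c d : ZMod 2) :
    cnotMatrix (a, b) (c, d) = if a = c ∧ b = d + c then 1 else 0 := by
  rcases zmod_two_cases a with rfl | rfl <;> rcases zmod_two_cases b with rfl | rfl <;>
  rcases zmod_two_cases c with rfl | rfl <;> rcases zmod_two_cases d with rfl | rfl <;>
  simp [cnotMatrix, finProdFinEquiv, zmod_two_add_self] <;> rfl

theorem gmat_CZ (i j : Fin n) (hij : i ≠ j) :
    gmat (Gate.CZ i j hij) = dg fun x => sgn (x i * x j) := by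
  ext x y
  have e : gmat (Gate.CZ i j hij) x y =
      if ∀ k, k ≠ i → k ≠ j → x k = y k then czMatrix (x i, x j) (y i, y j) else 0 := rfl
  rw [e, czMatrix_apply, dg, Matrix.diagonal_apply, ← ite_and]
  congr 1
  rw [eq_iff_iff, funext_iff]
  constructor
  · rintro ⟨h, h1, h2⟩ k
    by_cases hk : k = i
    · rw [hk, h1]
    · by_cases hk' : k = j
      · rw [hk', h2]
      · exact h k hk hk'
  · intro h
    exact ⟨fun k _ _ => h k, h i, h j⟩

/-- Addition of bit `i` to bit `j`. -/
def addBit (i j : Fin n) (x : Bits n) : Bits n := Function.update x j (x j + x i)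

theorem gmat_CNOT (i j : Fin n) (hij : i ≠ j) : gmat (Gate.CNOT i j hij) = fn (addBit i j) := by
  ext x y
  have e : gmat (Gate.CNOT i j hij) x y =
      if ∀ k, k ≠ i → k ≠ j → x k = y k then cnotMatrix (x i, x j) (y i, y j) else 0 := rfl
  rw [e, cnotMatrix_apply, fn, Matrix.of_apply, ← ite_and]
  congr 1
  rw [eq_iff_iff, funext_iff]
  constructor
  · rintro ⟨h, h1, h2⟩ k
    by_cases hk' : k = j
    · rw [hk', h2, addBit, Function.update_self]
    · rw [addBit, Function.update_of_ne hk']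
      by_cases hk : k = i
      · rw [hk, h1]
      · exact h k hk hk'
  · intro h
    refine ⟨fun k _ h2 => ?_, ?_, ?_⟩
    · simpa [addBit, Function.update_of_ne h2] using h k
    · simpa [addBit, Function.update_of_ne hij] using h i
    · simpa [addBit] using h j

/-! ### Implementations with bounded two-qubit depth -/

/-- `Impl S d U`: the operator `U` is computed by a circuit whose two-qubit gates act within `S`
and take at most `d` time steps. -/
def Impl (S : Finset (Fin n)) (d : ℕ) (U : Op n) : Prop :=
  ∃ c : Circuit n, cmat c = U ∧ ∀ t : Fin n → ℕ,
    (∀ k, k ∉ S → List.foldl Gate.schedule t c k = t k) ∧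
    ∀ T, (∀ k ∈ S, t k ≤ T) → ∀ k ∈ S, List.foldl Gate.schedule t c k ≤ T + d

theorem Impl.mono {S S' : Finset (Fin n)} {d d' : ℕ} {U : Op n} (h : Impl S d U) (hS : S ⊆ S')
    (hd : d ≤ d') : Impl S' d' U := by
  obtain ⟨c, hc, ht⟩ := h
  refine ⟨c, hc, fun t => ⟨fun k hk => (ht t).1 k fun h => hk (hS h), fun T hT k hk => ?_⟩⟩
  by_cases hkS : k ∈ S
  · exact ((ht t).2 T (fun k hk => hT k (hS hk)) k hkS).trans (by omega)
  · rw [(ht t).1 k hkS]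
    exact (hT k hk).trans (by omega)

/-- `Impl` bounds the finishing times for every initial schedule, so the second circuit may start
from whatever schedule the first one leaves, and depths add. -/
theorem Impl.mul {S : Finset (Fin n)} {d e : ℕ} {U V : Op n} (hU : Impl S d U)
    (hV : Impl S e V) : Impl S (d + e) (U * V) := by
  obtain ⟨c, hc, hct⟩ := hU
  obtain ⟨c', hc', hct'⟩ := hV
  refine ⟨c' ++ c, by rw [cmat_append, hc, hc'], fun t => ?_⟩
  rw [List.foldl_append]
  refine ⟨fun k hk => by rw [(hct _).1 k hk, (hct' t).1 k hk], fun T hT k hk => ?_⟩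
  have := (hct _).2 (T + e) ((hct' t).2 T hT) k hk
  omega

/-- A circuit leaves the clocks outside its own set unchanged, so circuits on disjoint sets share
their time steps and the depth does not grow. -/
theorem Impl.mul_disjoint {S S' : Finset (Fin n)} {d : ℕ} {U V : Op n} (hS : Disjoint S S')
    (hU : Impl S d U) (hV : Impl S' d V) : Impl (S ∪ S') d (U * V) := by
  obtain ⟨c, hc, hct⟩ := hU
  obtain ⟨c', hc', hct'⟩ := hV
  refine ⟨c' ++ c, by rw [cmat_append, hc, hc'], fun t => ?_⟩
  rw [List.foldl_append]
  refine ⟨fun k hk => ?_, fun T hT k hk => ?_⟩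
  · rw [Finset.mem_union, not_or] at hk
    rw [(hct _).1 k hk.1, (hct' t).1 k hk.2]
  · by_cases hkS : k ∈ S
    · refine (hct _).2 T (fun k hk => ?_) k hkS
      rw [(hct' t).1 k (Finset.disjoint_left.1 hS hk)]
      exact hT k (Finset.mem_union_left _ hk)
    · rw [(hct _).1 k hkS]
      refine (hct' t).2 T (fun k hk => hT k (Finset.mem_union_right _ hk)) k ?_
      exact (Finset.mem_union.1 hk).resolve_left hkS

theorem Impl.one : Impl (∅ : Finset (Fin n)) 0 1 :=
  ⟨[], cmat_nil, fun t => ⟨fun _ _ => rfl, by simp⟩⟩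

theorem Impl.mul_free {S : Finset (Fin n)} {d : ℕ} {U V : Op n} (hU : Impl S d U)
    (hV : Impl ∅ 0 V) : Impl S d (U * V) :=
  hU.mul (hV.mono (Finset.empty_subset S) le_rfl)

theorem Impl.free_mul {S : Finset (Fin n)} {d : ℕ} {U V : Op n} (hV : Impl ∅ 0 V)
    (hU : Impl S d U) : Impl S d (V * U) := by
  simpa using (hV.mono (Finset.empty_subset S) le_rfl).mul hU

theorem Impl.H (i : Fin n) : Impl ∅ 0 (had {i}) :=
  ⟨[Gate.H i], by rw [cmat_singleton, gmat_H], fun t => ⟨fun _ _ => rfl, by simp⟩⟩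

theorem Impl.P (i : Fin n) : Impl ∅ 0 (dg fun x => iota (x i)) :=
  ⟨[Gate.P i], by rw [cmat_singleton, gmat_P], fun t => ⟨fun _ _ => rfl, by simp⟩⟩

theorem Impl.CZ {i j : Fin n} (hij : i ≠ j) : Impl {i, j} 1 (dg fun x => sgn (x i * x j)) := by
  refine ⟨[Gate.CZ i j hij], by rw [cmat_singleton, gmat_CZ], fun t => ⟨fun k hk => ?_, ?_⟩⟩
  · simp only [mem_insert, mem_singleton] at hk
    simp [Gate.schedule, hk]
  · intro T hT k hk
    have h1 := hT i (by simp)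
    have h2 := hT j (by simp)
    simp only [mem_insert, mem_singleton] at hk
    simp [Gate.schedule, hk, h1, h2]

theorem Impl.CNOT {i j : Fin n} (hij : i ≠ j) : Impl {i, j} 1 (fn (addBit i j)) := by
  refine ⟨[Gate.CNOT i j hij], by rw [cmat_singleton, gmat_CNOT], fun t => ⟨fun k hk => ?_, ?_⟩⟩
  · simp only [mem_insert, mem_singleton] at hk
    simp [Gate.schedule, hk]
  · intro T hT k hk
    have h1 := hT i (by simp)
    have h2 := hT j (by simp)
    simp only [mem_insert, mem_singleton] at hk
    simp [Gate.schedule, hk, h1, h2]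

theorem Impl.had (S : Finset (Fin n)) : Impl ∅ 0 (had S) := by
  induction S using Finset.induction_on with
  | empty => rw [had_empty]; exact Impl.one
  | insert a s ha ih =>
    rw [Finset.insert_eq, ← had_union (by simpa using ha)]
    exact (Impl.H a).mul ih

theorem Impl.depth_le {d : ℕ} {c : Circuit n} (h : Impl univ d (cmat c)) :
    ∃ c' : Circuit n, Circuit.toMatrix c' = Circuit.toMatrix c ∧ Circuit.depth c' ≤ d := by
  obtain ⟨c', hc', ht⟩ := h
  refine ⟨c', toMatrix_eq_of_cmat_eq hc', Finset.sup_le fun k hk => ?_⟩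
  simpa using (ht fun _ => 0).2 0 (by simp) k hk

end CliffordDepth

namespace CliffordDepth

open Finset

/-! ### Vizing's theorem -/

section Vizing

variable {V C : Type*}

/-- A symmetric partial assignment of colours to pairs of vertices such that pairs with a common
vertex have distinct colours. -/
structure IsPartialColoring (c : V → V → Option C) : Prop where
  symm : ∀ x y, c x y = c y x
  proper : ∀ x y z a, c x y = some a → c x z = some a → y = z

/-- The colour `a` does not occur at the vertex `x`. -/
def IsMissing (c : V → V → Option C) (x : V) (a : C) : Prop := ∀ y, c x y ≠ some a

/-- The graph of the pairs with one of the colours `a`, `b`. -/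
def twoColored (c : V → V → Option C) (hc : IsPartialColoring c) (hd : ∀ x, c x x = none)
    (a b : C) : SimpleGraph V where
  Adj x y := c x y = some a ∨ c x y = some b
  symm := ⟨fun x y h => by rwa [hc.symm y x]⟩
  loopless := ⟨fun x h => by simp [hd] at h⟩

open Classical in
/-- The exchange of the colours `a` and `b` on a set of vertices. -/
noncomputable def kempe (c : V → V → Option C) (a b : C) (s : Set V) : V → V → Option C :=
  fun x y => if x ∈ s then (c x y).map (Equiv.swap a b) else c x y

/-- No edge coloured `a` or `b` leaves `s`, so the exchange affects such an edge at both ends or at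
neither. -/
theorem kempe_isPartialColoring {c : V → V → Option C} (hc : IsPartialColoring c) {a b : C}
    {s : Set V} (hs : ∀ x y, (c x y = some a ∨ c x y = some b) → (x ∈ s ↔ y ∈ s)) :
    IsPartialColoring (kempe c a b s) := by
  classical
  constructor
  · intro x y
    have h := hs x y
    unfold kempe
    rw [hc.symm y x]
    rcases hxy : c x y with _ | d
    · simp
    · by_cases hd : d = a ∨ d = b
      · have : x ∈ s ↔ y ∈ s := h (by rw [hxy]; simpa using hd)
        simp [this]
      · push Not at hd
        simp [Equiv.swap_apply_of_ne_of_ne hd.1 hd.2]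
  · intro x y z d h1 h2
    unfold kempe at h1 h2
    split_ifs at h1 h2 with hx
    · rw [Option.map_eq_some_iff] at h1 h2
      obtain ⟨e, he, h1⟩ := h1
      obtain ⟨e', he', h2⟩ := h2
      have : e = e' := (Equiv.swap a b).injective (h1.trans h2.symm)
      subst this
      exact hc.proper x y z e he he'
    · exact hc.proper x y z d h1 h2

/-- In a finite graph of maximum degree two, three distinct vertices of degree at most one are
not connected with each other. -/
theorem not_reachable_of_degree_le_two [Fintype V] (H : SimpleGraph V) [DecidableRel H.Adj]
    (hH : ∀ x, H.degree x ≤ 2) {u v w : V} (huv : u ≠ v) (huw : u ≠ w) (hvw : v ≠ w)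
    (hu : H.degree u ≤ 1) (hv : H.degree v ≤ 1) (hw : H.degree w ≤ 1)
    (h1 : H.Reachable u v) (h2 : H.Reachable u w) : False := by
  classical
  let K := H.connectedComponentMk u
  have hK : K.toSimpleGraph.Connected := K.connected_toSimpleGraph
  -- Count edges in the common component: connectedness gives at least `|K| - 1` edges, whereas
  -- three vertices of degree at most one push the degree sum down to at most `2|K| - 3`.
  have hcard := hK.card_vert_le_card_edgeSet_add_one
  have hsum := K.toSimpleGraph.sum_degrees_eq_twice_card_edges
  have hdeg : ∀ x : K, K.toSimpleGraph.degree x ≤ H.degree x := by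
    intro x
    rw [← SimpleGraph.card_neighborFinset_eq_degree, ← SimpleGraph.card_neighborFinset_eq_degree]
    refine Finset.card_le_card_of_injOn (fun y => (y : V)) ?_ ?_
    · intro y hy
      rw [Finset.mem_coe, SimpleGraph.mem_neighborFinset] at hy ⊢
      exact hy
    · intro y _ z _ h
      exact Subtype.ext h
  let u' : K := ⟨u, rfl⟩
  let v' : K := ⟨v, (SimpleGraph.ConnectedComponent.sound h1).symm⟩
  let w' : K := ⟨w, (SimpleGraph.ConnectedComponent.sound h2).symm⟩
  let A : Finset K := {u', v', w'}
  have hA : A.card = 3 := by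
    rw [Finset.card_eq_three]
    exact ⟨u', v', w', fun h => huv (congrArg Subtype.val h),
      fun h => huw (congrArg Subtype.val h), fun h => hvw (congrArg Subtype.val h), rfl⟩
  have h3 : ∑ x, K.toSimpleGraph.degree x + 3 ≤ 2 * Fintype.card K := by
    have : ∀ x, K.toSimpleGraph.degree x + (if x ∈ A then 1 else 0) ≤ 2 := by
      intro x
      have hx := hdeg x
      have hx' := hH x
      split_ifs with hxA
      · have : H.degree (x : V) ≤ 1 := by
          simp only [A, Finset.mem_insert, Finset.mem_singleton] at hxA
          rcases hxA with rfl | rfl | rfl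
          exacts [hu, hv, hw]
        omega
      · omega
    have h4 := Finset.sum_le_sum fun x (_ : x ∈ (Finset.univ : Finset K)) => this x
    rw [Finset.sum_add_distrib] at h4
    simp only [Finset.sum_const, Finset.card_univ, smul_eq_mul, Finset.sum_ite_mem,
      Finset.univ_inter, hA] at h4
    omega
  rw [Nat.card_eq_fintype_card, Nat.card_eq_fintype_card, ← SimpleGraph.edgeFinset_card] at hcard
  omega

/-- `c` colours all edges of `G` except the edge `vw`. -/
structure IsConfig (G : SimpleGraph V) (v w : V) (c : V → V → Option C) : Prop
    extends IsPartialColoring c where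
  adj : ∀ x y, c x y ≠ none → G.Adj x y
  total : ∀ x y, G.Adj x y → c x y = none → (x = v ∧ y = w) ∨ (x = w ∧ y = v)
  uncolored : c v w = none
  edge : G.Adj v w

/-- `c` colours all edges of `G`. -/
structure IsTotal (G : SimpleGraph V) (c : V → V → Option C) : Prop
    extends IsPartialColoring c where
  adj : ∀ x y, c x y ≠ none ↔ G.Adj x y

theorem IsConfig.exists_isTotal {G : SimpleGraph V} {v w : V} {c : V → V → Option C}
    (h : IsConfig G v w c) {a : C} (hv : IsMissing c v a) (hw : IsMissing c w a) :
    ∃ c' : V → V → Option C, IsTotal G c' := by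
  classical
  have hne := h.edge.ne
  refine ⟨fun x y => if (x = v ∧ y = w) ∨ (x = w ∧ y = v) then some a else c x y,
    ⟨⟨fun x y => ?_, ?_⟩, ?_⟩⟩
  · have := h.symm x y
    grind
  · intro x y z d h1 h2
    have := h.proper x y z d
    have e1 := hv y
    have e2 := hv z
    have e3 := hw y
    have e4 := hw z
    grind
  · intro x y
    have h1 := h.adj x y
    have h2 := h.total x y
    have h3 := h.edge
    have h4 := h.edge.symm
    grind

theorem IsConfig.self_eq_none {G : SimpleGraph V} {v w : V} {c : V → V → Option C}
    (h : IsConfig G v w c) (x : V) : c x x = none := by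
  by_contra hx
  exact G.loopless.irrefl x (h.adj x x hx)

/-- Kempe's argument: if the two-coloured component of `w` avoids `v`, exchanging `a` and `b` on it
makes `a` missing at both ends of the uncoloured edge, which can then be coloured. -/
theorem IsConfig.reachable {G : SimpleGraph V} {v w : V} {c : V → V → Option C}
    (h : IsConfig G v w c) (hno : ¬ ∃ c' : V → V → Option C, IsTotal G c') {a b : C}
    (hv : IsMissing c v a) (hw : IsMissing c w b) :
    (twoColored c h.toIsPartialColoring h.self_eq_none a b).Reachable w v := by
  classical
  by_contra hr
  apply hno
  set H := twoColored c h.toIsPartialColoring h.self_eq_none a b with hH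
  set s : Set V := {x | H.Reachable w x} with hs
  have hws : w ∈ s := SimpleGraph.Reachable.refl w
  have hvs : v ∉ s := hr
  have hc' : IsPartialColoring (kempe c a b s) := by
    refine kempe_isPartialColoring h.toIsPartialColoring fun x y hxy => ?_
    have hadj : H.Adj x y := hxy
    exact ⟨fun hx => SimpleGraph.Reachable.trans hx hadj.reachable,
      fun hy => SimpleGraph.Reachable.trans hy hadj.symm.reachable⟩
  have hnone : ∀ x y, kempe c a b s x y = none ↔ c x y = none := by
    intro x y
    unfold kempe
    split_ifs <;> simp
  have hconf : IsConfig G v w (kempe c a b s) :=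
    ⟨hc', fun x y hxy => h.adj x y (by rwa [Ne, hnone] at hxy),
      fun x y hxy hn => h.total x y hxy (by rwa [hnone] at hn), by rw [hnone]; exact h.uncolored,
      h.edge⟩
  refine hconf.exists_isTotal (a := a) (fun y => ?_) (fun y hy => ?_)
  · simpa [kempe, hvs] using hv y
  · simp only [kempe, hws, if_true, Option.map_eq_some_iff] at hy
    obtain ⟨d, hd, hda⟩ := hy
    have : d = b := by
      have := congrArg (Equiv.swap a b) hda
      simpa using this
    exact hw y (this ▸ hd)

/-! ### Shifting the colours along a fan -/

section Fan

open Classical in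
/-- The colouring that arises from `c` by giving each edge from `v` to `F` the colour `m` of its
end in `F`, and by removing the colour of `vw`. -/
noncomputable def fanShift (c : V → V → Option C) (m : V → C) (v w : V) (F : Set V) :
    V → V → Option C := fun x y =>
  if x = v then (if y ∈ F then some (m y) else if y = w then none else c x y)
  else if y = v then (if x ∈ F then some (m x) else if x = w then none else c x y)
  else c x y

/-- Each edge from `v` to `f i` takes the colour of the next edge of the fan, which is missing at `f
i` by choice of `m`. At `v` no clash arises: the previous bearer of that colour is recoloured
itself, or it is the last edge, which loses its colour. -/
theorem IsConfig.shiftFan {G : SimpleGraph V} {v : V} {f : ℕ → V} {c : V → V → Option C} {m : V → C}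
    (h : IsConfig G v (f 0) c) (hm : ∀ x, IsMissing c x (m x)) {k : ℕ}
    (hf : ∀ i < k, c v (f (i + 1)) = some (m (f i)))
    (hinj : ∀ i < k, ∀ j < k, m (f i) = m (f j) → i = j) (hk : ∀ i < k, f i ≠ f k) :
    IsConfig G v (f k) (fanShift c m v (f k) {x | ∃ i < k, f i = x}) := by
  classical
  set F : Set V := {x | ∃ i < k, f i = x} with hF
  have hkF : f k ∉ F := by rintro ⟨i, hi, hik⟩; exact hk i hi hik
  have hadj : ∀ i ≤ k, G.Adj v (f i) := by
    intro i hi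
    rcases i with _ | i
    · exact h.edge
    · exact h.adj _ _ (by rw [hf i (by omega)]; simp)
  have hFadj : ∀ x ∈ F, G.Adj v x := by rintro x ⟨i, hi, rfl⟩; exact hadj i hi.le
  have hvF : v ∉ F := fun hv => (hFadj v hv).ne rfl
  have hvk : v ≠ f k := (hadj k le_rfl).ne
  have hmF : ∀ y ∈ F, ∀ z ∈ F, m y = m z → y = z := by
    rintro y ⟨i, hi, rfl⟩ z ⟨j, hj, rfl⟩ hyz
    rw [hinj i hi j hj hyz]
  have hnext : ∀ y ∈ F, ∀ z, c v z = some (m y) → z ∈ F ∨ z = f k := by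
    rintro y ⟨i, hi, rfl⟩ z hz
    have hz' : z = f (i + 1) := h.proper v z (f (i + 1)) _ hz (hf i hi)
    rcases Nat.lt_or_ge (i + 1) k with hik | hik
    · exact Or.inl ⟨i + 1, hik, hz'.symm⟩
    · have : i + 1 = k := by omega
      exact Or.inr (by rw [hz', this])
  have h0 : f 0 ∈ F ∨ f 0 = f k := by
    rcases Nat.eq_zero_or_pos k with rfl | hk0
    · exact Or.inr rfl
    · exact Or.inl ⟨0, hk0, rfl⟩
  refine ⟨⟨fun x y => ?_, fun x y z d h1 h2 => ?_⟩, fun x y hxy => ?_, fun x y hxy hn => ?_, ?_,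
    hadj k le_rfl⟩
  · have := h.symm x y
    unfold fanShift
    grind
  · have e1 := h.proper x y z d
    have e2 := hmF y
    have e3 := hnext y
    have e4 := hnext z
    have e5 := hm x y
    have e6 := hm x z
    unfold fanShift at h1 h2
    grind
  · unfold fanShift at hxy
    have e1 := h.adj x y
    have e2 := hFadj x
    have e3 := hFadj y
    have e4 := fun hx => (hFadj x hx).symm
    grind
  · unfold fanShift at hn
    have e1 := h.total x y hxy
    grind
  · unfold fanShift
    simp [hkF]

/-- The effect of shifting a fan on the missing colours. -/
theorem IsConfig.shiftFan_isMissing {G : SimpleGraph V} {v : V} {f : ℕ → V}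
    {c : V → V → Option C} {m : V → C} (h : IsConfig G v (f 0) c)
    (hm : ∀ x, IsMissing c x (m x)) {k : ℕ}
    (hf : ∀ i < k, c v (f (i + 1)) = some (m (f i))) (hk : ∀ i < k, f i ≠ f k) (a : C) (ha : IsMissing c v a) :
    IsMissing (fanShift c m v (f k) {x | ∃ i < k, f i = x}) v a ∧
      IsMissing (fanShift c m v (f k) {x | ∃ i < k, f i = x}) (f k) (m (f k)) := by
  classical
  refine ⟨fun y hy => ?_, fun y hy => ?_⟩
  · have hFa : ∀ x ∈ {x | ∃ i < k, f i = x}, m x ≠ a := by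
      rintro x ⟨i, hi, rfl⟩ hx
      exact ha _ (hx ▸ hf i hi)
    have := hFa y
    have := ha y
    unfold fanShift at hy
    grind
  · have h1 := hm (f k) y
    have h2 := h.symm (f k) y
    have h3 : ∀ i ≤ k, f i ≠ v := by
      intro i hi
      rcases i with _ | i
      · exact h.edge.ne'
      · exact (h.adj _ _ (by rw [hf i (by omega)]; simp)).ne'
    have h4 := h3 k le_rfl
    have h5 : f k ∉ {x | ∃ i < k, f i = x} := by rintro ⟨i, hi, hik⟩; exact hk i hi hik
    unfold fanShift at hy
    grind

end Fan

/-- Follow the fan from `w` until the next missing colour is free at `v` or repeats. If it is free,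
shift the whole fan and use it. If it repeats, shift as far as `f l` and as far as `f k`: both
shifted configurations yield a two-coloured path to `v`. In terms of the original colouring this
puts `v`, `f l` and `f k` in one component of a graph of maximum degree two although each has degree
at most one. -/
theorem IsConfig.exists_total_of_fan [Fintype V] {G : SimpleGraph V} {v w : V}
    {c : V → V → Option C} (h : IsConfig G v w c)
    {m : V → C} (hm : ∀ x, IsMissing c x (m x)) :
    ∃ c' : V → V → Option C, IsTotal G c' := by
  classical
  by_contra hno
  -- The value `x` in the second case is immaterial: the fan is used only up to the first index at
  -- which no such neighbour exists.
  let g : V → V := fun x => if hx : ∃ y, c v y = some (m x) then hx.choose else x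
  have hg : ∀ x, (∃ y, c v y = some (m x)) → c v (g x) = some (m x) := by
    intro x hx
    simp only [g, hx, dif_pos]
    exact hx.choose_spec
  let f : ℕ → V := fun i => g^[i] w
  have hf0 : f 0 = w := rfl
  have hfs : ∀ i, f (i + 1) = g (f i) := fun i => Function.iterate_succ_apply' g i w
  have h' : IsConfig G v (f 0) c := h
  -- The sequence `f` runs in a finite set, so it repeats a vertex and with it a missing colour.
  have hex : ∃ k, IsMissing c v (m (f k)) ∨ ∃ l < k, m (f l) = m (f k) := by
    obtain ⟨i, j, hij, hfij⟩ := Finite.exists_ne_map_eq_of_infinite f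
    rcases lt_or_gt_of_ne hij with hlt | hlt
    · exact ⟨j, Or.inr ⟨i, hlt, by rw [hfij]⟩⟩
    · exact ⟨i, Or.inr ⟨j, hlt, by rw [hfij]⟩⟩
  set k := Nat.find hex with hk
  have hkspec := Nat.find_spec hex
  have hkmin : ∀ i < k, ¬ (IsMissing c v (m (f i)) ∨ ∃ l < i, m (f l) = m (f i)) :=
    fun i hi => Nat.find_min hex hi
  have hf : ∀ i < k, c v (f (i + 1)) = some (m (f i)) := by
    intro i hi
    have := hkmin i hi
    rw [hfs]
    apply hg
    simp only [IsMissing, not_or, not_forall, not_not] at this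
    exact this.1
  have hinj : ∀ i < k, ∀ j < k, m (f i) = m (f j) → i = j := by
    intro i hi j hj hij
    by_contra hne
    rcases lt_or_gt_of_ne hne with hlt | hlt
    · exact hkmin j hj (Or.inr ⟨i, hlt, hij⟩)
    · exact hkmin i hi (Or.inr ⟨j, hlt, hij.symm⟩)
  have hdist : ∀ j ≤ k, ∀ i < j, f i ≠ f j := by
    intro j hj i hi hij
    obtain ⟨j, rfl⟩ : ∃ j', j = j' + 1 := ⟨j - 1, by omega⟩
    have hj' := hf j (by omega)
    rcases i with _ | i
    · rw [← hij, hf0, h.uncolored] at hj'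
      simp at hj'
    · rw [← hij, hf i (by omega), Option.some.injEq] at hj'
      have := hinj i (by omega) j (by omega) hj'
      omega
  have hconf : ∀ j ≤ k, IsConfig G v (f j) (fanShift c m v (f j) {x | ∃ i < j, f i = x}) :=
    fun j hj => h'.shiftFan hm (fun i hi => hf i (by omega))
      (fun i hi l hl => hinj i (by omega) l (by omega)) (hdist j hj)
  have hmiss : ∀ j ≤ k, ∀ a, IsMissing c v a →
      IsMissing (fanShift c m v (f j) {x | ∃ i < j, f i = x}) v a ∧
      IsMissing (fanShift c m v (f j) {x | ∃ i < j, f i = x}) (f j) (m (f j)) :=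
    fun j hj a ha => h'.shiftFan_isMissing hm (fun i hi => hf i (by omega)) (hdist j hj) a ha
  by_cases hcase : IsMissing c v (m (f k))
  · have := hmiss k le_rfl _ hcase
    exact hno ((hconf k le_rfl).exists_isTotal this.1 this.2)
  obtain ⟨l, hl, hlk⟩ := hkspec.resolve_left hcase
  set a := m v with ha
  set b := m (f k) with hb
  have r1 := (hconf l hl.le).reachable hno (hmiss l hl.le a (hm v)).1 (hmiss l hl.le a (hm v)).2
  have r2 := (hconf k le_rfl).reachable hno (hmiss k le_rfl a (hm v)).1
    (hmiss k le_rfl a (hm v)).2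
  set H := twoColored c h.toIsPartialColoring h.self_eq_none a b with hH
  have hab : a ≠ b := by
    intro hab
    exact hcase (show IsMissing c v b from hab ▸ hm v)
  -- Among the shifted edges none receives `a`, and only the one to `f l` can receive `b`. Hence a
  -- two-coloured edge after the shift is an edge of `H`, or the edge from `v` to `f l` when the
  -- shift goes beyond `l`.
  have hedge : ∀ j ≤ k, (∀ i < j, m (f i) = b → i = l) → ∀ x y,
      (fanShift c m v (f j) {x | ∃ i < j, f i = x} x y = some a ∨
        fanShift c m v (f j) {x | ∃ i < j, f i = x} x y = some b) →
      (l < j ∧ ((x = v ∧ y = f l) ∨ (x = f l ∧ y = v))) ∨ H.Adj x y := by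
    intro j hj hjl x y hxy
    have hF : ∀ z ∈ {x | ∃ i < j, f i = x}, m z ≠ a ∧ (m z = b → l < j ∧ z = f l) := by
      rintro z ⟨i, hi, rfl⟩
      refine ⟨fun hz => hm v (f (i + 1)) ?_, fun hz => ?_⟩
      · rw [hf i (by omega), hz]
      · have := hjl i hi hz
        exact ⟨this ▸ hi, by rw [this]⟩
    have e1 := hF x
    have e2 := hF y
    have e3 : H.Adj x y ↔ c x y = some a ∨ c x y = some b := Iff.rfl
    unfold fanShift at hxy
    grind
  have hreach : ∀ (H' : SimpleGraph V), (∀ x y, H'.Adj x y → H.Reachable x y) →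
      ∀ x y, H'.Reachable x y → H.Reachable x y := by
    rintro H' hH' x y ⟨p⟩
    induction p with
    | nil => exact SimpleGraph.Reachable.refl _
    | cons hadj _ ih => exact (hH' _ _ hadj).trans ih
  have q1 : H.Reachable (f l) v := by
    refine hreach _ (fun x y hxy => ?_) _ _ r1
    refine ((hedge l hl.le (fun i hi hib => hinj i (by omega) l hl (hib.trans hlk.symm)) x y ?_
      ).resolve_left (fun h => lt_irrefl _ h.1)).reachable
    rw [hlk] at hxy
    exact hxy
  -- The possible new edge from `v` to `f l` is replaced by the path `q1`.
  have q2 : H.Reachable (f k) v := by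
    refine hreach _ (fun x y hxy => ?_) _ _ r2
    rcases hedge k le_rfl (fun i hi hib => hinj i hi l hl (hib.trans hlk.symm)) x y hxy with
      ⟨-, ⟨rfl, rfl⟩ | ⟨rfl, rfl⟩⟩ | hadj
    · exact q1.symm
    · exact q1
    · exact hadj.reachable
  have hdeg : ∀ x (s : Finset (Option C)), (∀ y, H.Adj x y → c x y ∈ s) → H.degree x ≤ s.card := by
    intro x s hs
    rw [← SimpleGraph.card_neighborFinset_eq_degree]
    refine Finset.card_le_card_of_injOn (fun y => c x y) (fun y hy => ?_) ?_
    · exact hs y (by simpa using hy)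
    · intro y hy z _ hyz
      have hadj : c x y = some a ∨ c x y = some b := (H.mem_neighborFinset x y).1 hy
      rcases hadj with h1 | h1
      · exact h.proper x y z a h1 (hyz.symm.trans h1)
      · exact h.proper x y z b h1 (hyz.symm.trans h1)
  have hne : ∀ i ≤ k, v ≠ f i := fun i hi => (hconf i hi).edge.ne
  refine not_reachable_of_degree_le_two H (fun x => ?_) (hne l hl.le) (hne k le_rfl)
    (hdist k le_rfl l hl) ?_ ?_ ?_ q1.symm q2.symm
  · exact (hdeg x {some a, some b} (fun y hy => by
      have : c x y = some a ∨ c x y = some b := hy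
      simpa using this)).trans Finset.card_le_two
  · exact hdeg v {some b} fun y hy => by simpa using Or.resolve_left hy (hm v y)
  · exact hdeg (f l) {some a} fun y hy => by
      simpa using Or.resolve_right hy (hlk ▸ hm (f l) y)
  · exact hdeg (f k) {some a} fun y hy => by simpa using Or.resolve_right hy (hm (f k) y)

/-- Vizing's theorem: the edges of a finite graph of maximum degree at most `d` can be coloured
with `d + 1` colours. -/
theorem exists_edge_coloring [Fintype V] (G : SimpleGraph V) [DecidableRel G.Adj] (d : ℕ)
    (hG : ∀ x, G.degree x ≤ d) :
    ∃ c : V → V → Option (Fin (d + 1)), IsTotal G c := by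
  classical
  induction hE : G.edgeFinset.card using Nat.strong_induction_on generalizing G with
  | _ e ih =>
  by_cases hbot : ∃ v w, G.Adj v w
  · obtain ⟨v, w, hvw⟩ := hbot
    let G' := G.deleteEdges {s(v, w)}
    have hle : G' ≤ G := SimpleGraph.deleteEdges_le _
    have hlt : G'.edgeFinset.card < e := by
      rw [← hE]
      refine Finset.card_lt_card ((SimpleGraph.edgeFinset_ssubset_edgeFinset).2 ?_)
      refine lt_of_le_of_ne hle fun heq => ?_
      have : G'.Adj v w := heq ▸ hvw
      simp [G'] at this
    obtain ⟨c, hc⟩ := ih _ hlt G' (fun x => (SimpleGraph.degree_le_of_le hle).trans (hG x)) rfl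
    have hadj : ∀ x y, G'.Adj x y ↔ G.Adj x y ∧ ¬ ((x = v ∧ y = w) ∨ (x = w ∧ y = v)) := by
      intro x y
      simp [G', SimpleGraph.deleteEdges_adj]
    have hconf : IsConfig G v w c := by
      refine ⟨hc.toIsPartialColoring, fun x y hxy => hle ((hc.adj x y).1 hxy), fun x y hxy hn => ?_,
        ?_, hvw⟩
      · by_contra hcon
        exact (hc.adj x y).2 ((hadj x y).2 ⟨hxy, hcon⟩) hn
      · by_contra hcon
        exact ((hadj v w).1 ((hc.adj v w).1 hcon)).2 (Or.inl ⟨rfl, rfl⟩)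
    -- Pigeonhole: at most `d` edges meet `x` and there are `d + 1` colours.
    have hm : ∀ x, ∃ a, IsMissing c x a := by
      intro x
      by_contra hcon
      simp only [IsMissing, not_exists, not_forall, not_not] at hcon
      choose y hy using hcon
      have : (Finset.univ : Finset (Fin (d + 1))).card ≤ (G.neighborFinset x).card := by
        refine Finset.card_le_card_of_injOn y (fun a _ => ?_) (fun a _ b _ hab => ?_)
        · have : G.Adj x (y a) := hconf.adj _ _ (by rw [hy]; simp)
          simpa using this
        · have := hy a
          rw [hab, hy b] at this
          simpa using this.symm
      rw [SimpleGraph.card_neighborFinset_eq_degree, Finset.card_univ, Fintype.card_fin] at this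
      have := hG x
      omega
    choose m hm using hm
    exact hconf.exists_total_of_fan hm
  · push Not at hbot
    exact ⟨fun _ _ => none, ⟨⟨fun _ _ => rfl, by simp⟩, fun x y => by simp [hbot x y]⟩⟩

end Vizing
end CliffordDepth

namespace CliffordDepth

open Finset

variable {n : ℕ}

/-! ### Circuits of CZ gates -/

/-- The circuit with a CZ gate on each of the pairs in `E`. -/
def czPhase (E : Finset (Fin n × Fin n)) : Op n := dg fun x => sgn (∑ p ∈ E, x p.1 * x p.2)

theorem czPhase_empty : czPhase (∅ : Finset (Fin n × Fin n)) = 1 := by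
  simpa [czPhase] using dg_one

theorem czPhase_union {E F : Finset (Fin n × Fin n)} (h : Disjoint E F) :
    czPhase (E ∪ F) = czPhase E * czPhase F := by
  rw [czPhase, czPhase, czPhase, dg_mul_dg]
  congr 1; funext x
  rw [sum_union h, sgn_add]

theorem czPhase_singleton (p : Fin n × Fin n) :
    czPhase {p} = dg fun x => sgn (x p.1 * x p.2) := by
  simp [czPhase]

/-- The pairs `p`, `q` have no common element. -/
def DisjointPairs (p q : Fin n × Fin n) : Prop :=
  p.1 ≠ q.1 ∧ p.1 ≠ q.2 ∧ p.2 ≠ q.1 ∧ p.2 ≠ q.2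

theorem Impl.czPhase_matching {E : Finset (Fin n × Fin n)} (hE : ∀ p ∈ E, p.1 ≠ p.2)
    (h : ∀ p ∈ E, ∀ q ∈ E, p ≠ q → DisjointPairs p q) :
    Impl (E.biUnion fun p => {p.1, p.2}) 1 (czPhase E) := by
  induction E using Finset.induction_on with
  | empty => rw [czPhase_empty]; exact Impl.one.mono (empty_subset _) (by omega)
  | insert p E hp ih =>
    rw [insert_eq, czPhase_union (by simpa using hp), union_biUnion, czPhase_singleton]
    refine Impl.mul_disjoint ?_ ?_ (ih (fun q hq => hE q (mem_insert_of_mem hq))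
      fun q hq r hr => h q (mem_insert_of_mem hq) r (mem_insert_of_mem hr))
    · rw [singleton_biUnion, disjoint_biUnion_right]
      intro q hq
      obtain ⟨h1, h2, h3, h4⟩ := h p (mem_insert_self _ _) q (mem_insert_of_mem hq)
        (fun hpq => hp (hpq ▸ hq))
      simp [h1.symm, h2.symm, h3.symm, h4.symm]
    · rw [singleton_biUnion]
      exact Impl.CZ (hE p (mem_insert_self _ _))

/-- CZ gates commute, and each colour class is a matching, hence a single time step. -/
theorem Impl.czPhase_coloring {E : Finset (Fin n × Fin n)} {S : Finset (Fin n)}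
    (hS : ∀ p ∈ E, p.1 ∈ S ∧ p.2 ∈ S) (hE : ∀ p ∈ E, p.1 ≠ p.2) (d : ℕ)
    (col : Fin n × Fin n → ℕ) (hcol : ∀ p ∈ E, col p < d)
    (h : ∀ p ∈ E, ∀ q ∈ E, p ≠ q → col p = col q → DisjointPairs p q) :
    Impl S d (czPhase E) := by
  induction d generalizing E with
  | zero =>
    have : E = ∅ := eq_empty_of_forall_notMem fun p hp => absurd (hcol p hp) (by omega)
    rw [this, czPhase_empty]
    exact Impl.one.mono (empty_subset _) le_rfl
  | succ d ih =>
    have : E = E.filter (fun p => col p < d) ∪ E.filter (fun p => ¬ col p < d) :=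
      (filter_union_filter_not_eq _ _).symm
    rw [this, czPhase_union (disjoint_filter_filter_not _ _ _)]
    refine Impl.mul (ih ?_ ?_ ?_ ?_) ((Impl.czPhase_matching ?_ ?_).mono ?_ le_rfl)
    · exact fun p hp => hS p (mem_filter.1 hp).1
    · exact fun p hp => hE p (mem_filter.1 hp).1
    · exact fun p hp => (mem_filter.1 hp).2
    · exact fun p hp q hq => h p (mem_filter.1 hp).1 q (mem_filter.1 hq).1
    · exact fun p hp => hE p (mem_filter.1 hp).1
    · intro p hp q hq hpq
      rw [mem_filter] at hp hq
      have h1 := hcol p hp.1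
      have h2 := hcol q hq.1
      exact h p hp.1 q hq.1 hpq (by omega)
    · intro k hk
      rw [mem_biUnion] at hk
      obtain ⟨p, hp, hk⟩ := hk
      have := hS p (mem_filter.1 hp).1
      simp only [mem_insert, mem_singleton] at hk
      rcases hk with rfl | rfl
      exacts [this.1, this.2]

/-- Vizing's theorem supplies the colouring. The hypothesis `hE` excludes loops and lets each edge
occur in only one orientation. -/
theorem Impl.czPhase_of_degree_le {E : Finset (Fin n × Fin n)} {S : Finset (Fin n)}
    (hS : ∀ p ∈ E, p.1 ∈ S ∧ p.2 ∈ S) (hE : ∀ u v, (u, v) ∈ E → (v, u) ∉ E) (d : ℕ)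
    (hd : ∀ v, (univ.filter fun u => (v, u) ∈ E ∨ (u, v) ∈ E).card ≤ d) :
    Impl S (d + 1) (czPhase E) := by
  classical
  let G : SimpleGraph (Fin n) :=
    { Adj := fun u v => (u, v) ∈ E ∨ (v, u) ∈ E
      symm := ⟨fun u v h => h.symm⟩
      loopless := ⟨fun u h => hE u u (h.elim id id) (h.elim id id)⟩ }
  obtain ⟨c, hc⟩ := exists_edge_coloring G d (fun v => by
    rw [← SimpleGraph.card_neighborFinset_eq_degree]
    refine (card_le_card fun u hu => ?_).trans (hd v)
    have : (v, u) ∈ E ∨ (u, v) ∈ E := (G.mem_neighborFinset v u).1 hu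
    simpa using this)
  have hsome : ∀ p ∈ E, ∃ a, c p.1 p.2 = some a := fun p hp =>
    Option.ne_none_iff_exists'.1 ((hc.adj p.1 p.2).2 (Or.inl hp))
  -- The default colour `0` never matters, since every pair in `E` is coloured.
  refine Impl.czPhase_coloring hS (fun p hp hpp => ?_) (d + 1)
    (fun p => ((c p.1 p.2).getD 0 : Fin (d + 1))) (fun p _ => Fin.is_lt _) ?_
  · have hp' : (p.1, p.2) ∈ E := hp
    rw [hpp] at hp'
    exact hE _ _ hp' hp'
  · rintro ⟨p1, p2⟩ hp ⟨q1, q2⟩ hq hpq hcol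
    obtain ⟨a, ha⟩ := hsome _ hp
    obtain ⟨b, hb⟩ := hsome _ hq
    simp only at ha hb
    simp only [ha, hb, Option.getD_some] at hcol
    have hab : a = b := Fin.ext hcol
    subst hab
    have ha' := (hc.symm p2 p1).trans ha
    have hb' := (hc.symm q2 q1).trans hb
    refine ⟨?_, ?_, ?_, ?_⟩
    · rintro h
      simp only at h
      subst h
      exact hpq (by rw [hc.proper _ _ _ _ ha hb])
    · rintro h
      simp only at h
      subst h
      have := hc.proper _ _ _ _ ha hb'
      subst this
      exact hE _ _ hp hq
    · rintro h
      simp only at h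
      subst h
      have := hc.proper _ _ _ _ ha' hb
      subst this
      exact hE _ _ hp hq
    · rintro h
      simp only at h
      subst h
      exact hpq (by rw [hc.proper _ _ _ _ ha' hb'])

/-- A bipartite graph with parts of at most `m` vertices takes at most `m` time steps. -/
theorem Impl.czPhase_bipartite {E : Finset (Fin n × Fin n)} {X Y : Finset (Fin n)}
    (hXY : Disjoint X Y) (hE : E ⊆ X ×ˢ Y) {m : ℕ} (hX : X.card ≤ m) (hY : Y.card ≤ m) :
    Impl (X ∪ Y) m (czPhase E) := by
  classical
  have hidx : ∀ Z : Finset (Fin n), Z.card ≤ m →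
      ∃ f : Fin n → ℕ, (∀ k ∈ Z, f k < m) ∧ ∀ k ∈ Z, ∀ l ∈ Z, f k = f l → k = l := by
    intro Z hZ
    refine ⟨fun k => if h : k ∈ Z then Z.equivFin ⟨k, h⟩ else 0, fun k hk => ?_,
      fun k hk l hl h => ?_⟩
    · simp only [hk, dif_pos]
      exact (Fin.is_lt _).trans_le hZ
    · simp only [hk, hl, dif_pos] at h
      simpa using Z.equivFin.injective (Fin.ext h)
  obtain ⟨f, hf, hf'⟩ := hidx X hX
  obtain ⟨g, hg, hg'⟩ := hidx Y hY
  have hmem : ∀ p ∈ E, p.1 ∈ X ∧ p.2 ∈ Y := fun p hp => mem_product.1 (hE hp)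
  have hne : ∀ k ∈ X, ∀ l ∈ Y, k ≠ l := fun k hk l hl h => disjoint_left.1 hXY hk (h ▸ hl)
  -- Number the vertices of each part below `m`; the sum of the two numbers modulo `m` is the Latin
  -- square colouring of the complete bipartite graph.
  refine Impl.czPhase_coloring (fun p hp => ⟨mem_union_left _ (hmem p hp).1,
    mem_union_right _ (hmem p hp).2⟩) (fun p hp => hne _ (hmem p hp).1 _ (hmem p hp).2) m
    (fun p => (f p.1 + g p.2) % m) (fun p hp => Nat.mod_lt _ ?_) ?_
  · exact (Nat.zero_le _).trans_lt (hf _ (hmem p hp).1)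
  · intro p hp q hq hpq hcol
    obtain ⟨hp1, hp2⟩ := hmem p hp
    obtain ⟨hq1, hq2⟩ := hmem q hq
    refine ⟨fun h => hpq (Prod.ext h ?_), hne _ hp1 _ hq2, (hne _ hq1 _ hp2).symm,
      fun h => hpq (Prod.ext ?_ h)⟩
    · refine hg' _ hp2 _ hq2 ?_
      rw [h] at hcol
      have := Nat.ModEq.add_left_cancel' _ hcol
      exact this.eq_of_lt_of_lt (hg _ hp2) (hg _ hq2)
    · refine hf' _ hp1 _ hq1 ?_
      rw [h] at hcol
      have := Nat.ModEq.add_right_cancel' _ hcol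
      exact this.eq_of_lt_of_lt (hf _ hp1) (hf _ hq1)

/-! ### Switching -/

/-- The symmetric relation `M`, restricted to the graph `K`, can be switched so that at each vertex
at most half of the edges of `K` belong to it. -/
theorem exists_switching {V : Type*} [Fintype V] [DecidableEq V] (K : SimpleGraph V)
    [DecidableRel K.Adj] (M : V → V → ZMod 2) (hM : ∀ u v, M u v = M v u) :
    ∃ σ : V → ZMod 2, ∀ v,
      2 * (univ.filter fun u => K.Adj v u ∧ M v u + (σ v + σ u) = 1).card ≤ K.degree v := by
  let ε : ZMod 2 → ℤ := fun a => if a = 0 then 1 else -1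
  have hε : ∀ a b, ε (a + b) = ε a * ε b := by decide
  let J : V → V → ℤ := fun u v => if K.Adj u v then ε (M u v) else 0
  have hJ : ∀ u v, J u v = J v u := by
    intro u v
    simp only [J, K.adj_comm u v, hM u v]
  let W : (V → ZMod 2) → ℤ := fun σ => ∑ u, ∑ v, J u v * (ε (σ u) * ε (σ v))
  -- `W` counts agreements minus disagreements over adjacent ordered pairs. Changing `σ v` negates
  -- the contribution of `v`, which enters twice, so `W` drops by four times the local sum at `v`;
  -- at a maximum all local sums are nonnegative, so at most half of the edges at `v` carry a one.
  obtain ⟨σ, hσ⟩ := Finite.exists_max W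
  refine ⟨σ, fun v => ?_⟩
  have h1 := hσ (Function.update σ v (σ v + 1))
  have hs : ∀ u, ε (Function.update σ v (σ v + 1) u) =
      ε (σ u) + (if u = v then -2 * ε (σ v) else 0) := by
    intro u
    by_cases huv : u = v
    · subst huv
      rw [Function.update_self, hε, if_pos rfl]
      have : ε 1 = -1 := by decide
      rw [this]; ring
    · rw [Function.update_of_ne huv, if_neg huv, add_zero]
  have h2 : W (Function.update σ v (σ v + 1)) =
      W σ - 4 * ∑ u, J v u * (ε (σ v) * ε (σ u)) := by
    have hJv : J v v = 0 := by simp [J]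
    simp only [W, hs, mul_add, add_mul, sum_add_distrib, ite_mul, mul_ite, zero_mul, mul_zero,
      sum_ite_eq', mem_univ, if_true]
    have e1 : ∑ x, ∑ y, (if x = v then J x y * (-2 * ε (σ v) * ε (σ y)) else 0) =
        -2 * ∑ u, J v u * (ε (σ v) * ε (σ u)) := by
      rw [sum_comm, mul_sum]
      refine sum_congr rfl fun y _ => ?_
      rw [sum_ite_eq' univ v, if_pos (mem_univ v)]
      ring
    have e2 : ∑ x, J x v * (ε (σ x) * (-2 * ε (σ v))) =
        -2 * ∑ u, J v u * (ε (σ v) * ε (σ u)) := by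
      rw [mul_sum]
      refine sum_congr rfl fun y _ => ?_
      rw [hJ y v]
      ring
    rw [e1, e2, hJv]
    ring
  have h3 : 0 ≤ ∑ u, J v u * (ε (σ v) * ε (σ u)) := by linarith
  have h4 : ∑ u, J v u * (ε (σ v) * ε (σ u)) = (K.degree v : ℤ) -
      2 * ((univ.filter fun u => K.Adj v u ∧ M v u + (σ v + σ u) = 1).card : ℤ) := by
    rw [← SimpleGraph.card_neighborFinset_eq_degree, SimpleGraph.neighborFinset_eq_filter,
      card_filter, card_filter]
    push_cast
    rw [mul_sum, ← sum_sub_distrib]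
    refine sum_congr rfl fun u _ => ?_
    rw [← hε]
    simp only [J]
    by_cases hK : K.Adj v u
    · simp only [hK, if_true, true_and, ← hε]
      generalize M v u + (σ v + σ u) = a
      revert a; decide
    · simp [hK]
  omega

/-! ### Phases of products of parities -/

theorem addBit_addBit {i j : Fin n} (hij : i ≠ j) (x : Bits n) :
    addBit i j (addBit i j x) = x := by
  funext k
  by_cases hk : k = j
  · subst hk
    simp [addBit, Function.update_of_ne hij, add_assoc, zmod_two_add_self]
  · simp [addBit, Function.update_of_ne hk]

/-- The parity of the bits in `R` is computed in place in depth `⌈log₂ |R|⌉`. -/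
theorem exists_fanIn (R : Finset (Fin n)) (hR : R.Nonempty) :
    ∃ r ∈ R, ∃ g g' : Bits n → Bits n, (∀ x, g' (g x) = x) ∧ (∀ x, g x r = ∑ k ∈ R, x k) ∧
      (∀ x, ∀ k ∉ R, g x k = x k) ∧
      Impl R (Nat.clog 2 R.card) (fn g) ∧ Impl R (Nat.clog 2 R.card) (fn g') := by
  induction hc : R.card using Nat.strong_induction_on generalizing R with
  | _ m ih =>
  rcases Nat.lt_or_ge m 2 with hm | hm
  · have h1 : R.card = 1 := by have := hR.card_pos; omega
    obtain ⟨r, rfl⟩ := card_eq_one.1 h1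
    refine ⟨r, mem_singleton_self r, fun x => x, fun x => x, fun _ => rfl, by simp,
      fun _ _ _ => rfl, ?_, ?_⟩ <;>
    · rw [fn_id]
      exact Impl.one.mono (empty_subset _) (Nat.zero_le _)
  -- The two halves are treated in parallel, and one CNOT adds the first parity to the second; the
  -- larger half, of size `(m + 1) / 2`, determines the depth.
  · obtain ⟨R₁, hR₁, hc₁⟩ := exists_subset_card_eq (s := R) (n := (m + 1) / 2) (by omega)
    have hc₂ : (R \ R₁).card = m / 2 := by
      rw [card_sdiff_of_subset hR₁]; omega
    have hd : Disjoint R₁ (R \ R₁) := disjoint_sdiff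
    have hu : R₁ ∪ (R \ R₁) = R := union_sdiff_of_subset hR₁
    obtain ⟨r₁, hr₁, g₁, g₁', i₁, s₁, o₁, I₁, I₁'⟩ := ih _ (by omega) R₁
      (card_pos.1 (by omega)) hc₁
    obtain ⟨r₂, hr₂, g₂, g₂', i₂, s₂, o₂, I₂, I₂'⟩ := ih _ (by omega) (R \ R₁)
      (card_pos.1 (by omega)) hc₂
    have hr : r₁ ≠ r₂ := fun h => disjoint_left.1 hd hr₁ (h ▸ hr₂)
    have hr₁R : r₁ ∈ R := hR₁ hr₁
    have hr₂R : r₂ ∈ R := sdiff_subset hr₂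
    have hlog : Nat.clog 2 m = Nat.clog 2 ((m + 1) / 2) + 1 := by
      rw [Nat.clog_of_two_le one_lt_two hm]; rfl
    have hlog₂ : Nat.clog 2 (m / 2) ≤ Nat.clog 2 ((m + 1) / 2) := Nat.clog_mono_right _ (by omega)
    have hpair : ({r₁, r₂} : Finset (Fin n)) ⊆ R := by
      intro k hk
      simp only [mem_insert, mem_singleton] at hk
      rcases hk with rfl | rfl <;> assumption
    refine ⟨r₂, hr₂R, fun x => addBit r₁ r₂ (g₁ (g₂ x)), fun x => g₂' (g₁' (addBit r₁ r₂ x)),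
      fun x => ?_, fun x => ?_, fun x k hk => ?_, ?_, ?_⟩
    · simp only [addBit_addBit hr, i₁, i₂]
    · simp only [addBit, Function.update_self]
      rw [o₁ _ _ (disjoint_right.1 hd hr₂), s₂, s₁, ← sum_sdiff hR₁ (f := x)]
      congr 1
      exact sum_congr rfl fun k hk => o₂ _ _ (disjoint_left.1 hd hk)
    · have hk₁ : k ∉ R₁ := fun h => hk (hR₁ h)
      have hk₂ : k ∉ R \ R₁ := fun h => hk (sdiff_subset h)
      have hkr : k ≠ r₂ := fun h => hk (h ▸ hr₂R)
      simp only [addBit, Function.update_of_ne hkr]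
      rw [o₁ _ _ hk₁, o₂ _ _ hk₂]
    · rw [← fn_mul_fn (addBit r₁ r₂), ← fn_mul_fn g₁, hlog, add_comm]
      refine ((Impl.CNOT hr).mono hpair le_rfl).mul ?_
      rw [← hu]
      exact I₁.mul_disjoint hd (I₂.mono subset_rfl hlog₂)
    · rw [← fn_mul_fn g₂' fun x => g₁' (addBit r₁ r₂ x), ← fn_mul_fn g₁' (addBit r₁ r₂), hlog,
        ← mul_assoc]
      refine Impl.mul ?_ ((Impl.CNOT hr).mono hpair le_rfl)
      rw [← hu, union_comm]
      exact (I₂'.mono subset_rfl hlog₂).mul_disjoint hd.symm I₁'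

/-- The phase `(-1) ^ (|x ∩ R| |x ∩ R'|)`. -/
def cutPhase (R R' : Finset (Fin n)) : Op n := dg fun x => sgn ((∑ k ∈ R, x k) * ∑ k ∈ R', x k)

/-- Collect the two parities in one bit of each set, apply a single CZ to these bits and undo the
collection. The sets are disjoint, so both parities are handled simultaneously. -/
theorem Impl.cutPhase {R R' : Finset (Fin n)} (h : Disjoint R R') {m : ℕ} (hR : R.card ≤ m)
    (hR' : R'.card ≤ m) : Impl (R ∪ R') (2 * Nat.clog 2 m + 1) (cutPhase R R') := by
  have htriv : Impl (R ∪ R') (2 * Nat.clog 2 m + 1) 1 :=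
    Impl.one.mono (empty_subset _) (Nat.zero_le _)
  rcases R.eq_empty_or_nonempty with rfl | hne
  · convert htriv using 1
    simpa [CliffordDepth.cutPhase] using dg_one
  rcases R'.eq_empty_or_nonempty with rfl | hne'
  · convert htriv using 1
    simpa [CliffordDepth.cutPhase] using dg_one
  obtain ⟨r₁, hr₁, g₁, g₁', i₁, s₁, o₁, I₁, I₁'⟩ := exists_fanIn R hne
  obtain ⟨r₂, hr₂, g₂, g₂', i₂, s₂, o₂, I₂, I₂'⟩ := exists_fanIn R' hne'
  have hr : r₁ ≠ r₂ := fun e => disjoint_left.1 h hr₁ (e ▸ hr₂)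
  have e : CliffordDepth.cutPhase R R' =
      (fn g₂' * fn g₁') * (dg fun x => sgn (x r₁ * x r₂)) * (fn g₁ * fn g₂) := by
    rw [fn_mul_fn, fn_mul_fn, fn_dg_fn (fun x => by rw [i₁, i₂]), CliffordDepth.cutPhase]
    congr 1; funext x
    rw [s₁, o₁ _ _ (disjoint_right.1 h hr₂), s₂]
    congr 2
    exact sum_congr rfl fun k hk => (o₂ _ _ (disjoint_left.1 h hk)).symm
  have hl := Nat.clog_mono_right 2 hR
  have hl' := Nat.clog_mono_right 2 hR'
  have hpair : ({r₁, r₂} : Finset (Fin n)) ⊆ R ∪ R' := by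
    intro k hk
    simp only [mem_insert, mem_singleton] at hk
    rcases hk with rfl | rfl
    exacts [mem_union_left _ hr₁, mem_union_right _ hr₂]
  rw [e, show 2 * Nat.clog 2 m + 1 = Nat.clog 2 m + 1 + Nat.clog 2 m by ring]
  refine Impl.mul (Impl.mul ?_ ((Impl.CZ hr).mono hpair le_rfl)) ?_
  · rw [union_comm]
    exact (I₂'.mono subset_rfl hl').mul_disjoint h.symm (I₁'.mono subset_rfl hl)
  · exact (I₁.mono subset_rfl hl).mul_disjoint h (I₂.mono subset_rfl hl')

end CliffordDepth

namespace CliffordDepth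

open Finset

variable {n : ℕ}

/-! ### CZ circuits in about half the depth, by switching along a cut -/

theorem sum_filter_eq_one (S : Finset (Fin n)) (σ x : Fin n → ZMod 2) :
    ∑ k ∈ S.filter (fun k => σ k = 1), x k = ∑ k ∈ S, σ k * x k := by
  rw [sum_filter]
  refine sum_congr rfl fun k _ => ?_
  rcases zmod_two_cases (σ k) with h | h <;> simp [h]

theorem sum_filter_eq_zero (S : Finset (Fin n)) (σ x : Fin n → ZMod 2) :
    ∑ k ∈ S.filter (fun k => σ k = 0), x k = ∑ k ∈ S, (1 + σ k) * x k := by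
  rw [sum_filter]
  refine sum_congr rfl fun k _ => ?_
  rcases zmod_two_cases (σ k) with h | h <;> simp [h, zmod_two_add_self]

theorem sum_pairs {M : Type*} [AddCommMonoid M] (f : Fin n × Fin n → M) :
    ∑ p, f p = ∑ p with p.1 < p.2, (f p + f p.swap) + ∑ k, f (k, k) := by
  rw [sum_add_distrib, ← sum_filter_add_sum_filter_not univ (fun p : Fin n × Fin n => p.1 < p.2),
    ← sum_filter_add_sum_filter_not (univ.filter fun p : Fin n × Fin n => ¬ p.1 < p.2)
      (fun p => p.2 < p.1), add_assoc]
  congr 1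
  congr 1
  · refine sum_nbij' Prod.swap Prod.swap ?_ ?_ ?_ ?_ ?_
    · intro p hp
      simp only [mem_filter] at hp
      simpa using hp.2
    · intro p hp
      simp only [mem_filter] at hp
      simpa using ⟨hp.2.le, hp.2⟩
    · simp
    · simp
    · simp
  · refine sum_nbij' Prod.fst (fun k => (k, k)) ?_ ?_ ?_ ?_ ?_
    · simp
    · simp
    · intro p hp
      simp only [mem_filter, mem_univ, true_and, not_lt] at hp
      exact Prod.ext rfl (le_antisymm hp.2 hp.1)
    · simp
    · intro p hp
      simp only [mem_filter, mem_univ, true_and, not_lt] at hp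
      rw [show p = (p.1, p.1) from Prod.ext rfl (le_antisymm hp.1 hp.2)]

theorem sum_edges_eq (F E : Finset (Fin n × Fin n)) (hE : E ⊆ F) (c : Fin n × Fin n → ZMod 2)
    (hc : ∀ p ∈ F, c p = if p ∈ E then 1 else 0) (x : Bits n) :
    ∑ p ∈ E, x p.1 * x p.2 = ∑ p ∈ F, c p * (x p.1 * x p.2) := by
  rw [← sum_subset hE (f := fun p => c p * (x p.1 * x p.2))]
  · exact sum_congr rfl fun p hp => by rw [hc p (hE hp), if_pos hp, one_mul]
  · exact fun p hp hpE => by rw [hc p hp, if_neg hpE, zero_mul]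

/-- Any set of CZ gates takes about `n / 2` time steps. -/
theorem Impl.czPhase_univ (E : Finset (Fin n × Fin n)) (hE : ∀ p ∈ E, p.1 < p.2) :
    Impl univ ((n - 1) / 2 + 1 + (2 * Nat.clog 2 n + 1)) (czPhase E) := by
  classical
  let M : Fin n → Fin n → ZMod 2 := fun u v => if (u, v) ∈ E ∨ (v, u) ∈ E then 1 else 0
  have hM : ∀ u v, M u v = M v u := fun u v => by simp only [M, or_comm]
  obtain ⟨σ, hσ⟩ := exists_switching (⊤ : SimpleGraph (Fin n)) M hM
  let L : Finset (Fin n × Fin n) := univ.filter fun p => p.1 < p.2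
  let E' := L.filter fun p => M p.1 p.2 + (σ p.1 + σ p.2) = 1
  let R := univ.filter fun k => σ k = 1
  let R' := univ.filter fun k => σ k = 0
  have hlt : ∀ p ∈ E', p.1 < p.2 := fun p hp => (mem_filter.1 (mem_filter.1 hp).1).2
  -- Modulo two, the cut between `R` and `R'` contains the pair `u, v` exactly when `σ u + σ v = 1`,
  -- so the graph `E` is the symmetric difference of the switched graph `E'` and the cut.
  have e : CliffordDepth.czPhase E = CliffordDepth.czPhase E' * CliffordDepth.cutPhase R R' := by
    rw [CliffordDepth.czPhase, CliffordDepth.czPhase, CliffordDepth.cutPhase, dg_mul_dg]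
    congr 1; funext x
    rw [← sgn_add, sum_filter_eq_one, sum_filter_eq_zero, sum_mul_sum, ← sum_product',
      univ_product_univ, sum_pairs,
      sum_edges_eq L E (fun p hp => mem_filter.2 ⟨mem_univ p, hE p hp⟩) (fun p => M p.1 p.2) ?_,
      sum_edges_eq L E' (filter_subset _ _) (fun p => M p.1 p.2 + (σ p.1 + σ p.2)) ?_]
    · congr 1
      have h0 : ∑ k : Fin n, σ (k, k).1 * x (k, k).1 * ((1 + σ (k, k).2) * x (k, k).2) = 0 := by
        refine sum_eq_zero fun k _ => ?_
        rcases zmod_two_cases (σ k) with h | h <;> simp [h, zmod_two_add_self]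
      rw [h0, add_zero, ← sum_add_distrib]
      refine sum_congr rfl fun p _ => ?_
      simp only [Prod.fst_swap, Prod.snd_swap]
      generalize M p.1 p.2 = a
      generalize σ p.1 = b
      generalize σ p.2 = c
      generalize x p.1 = d
      generalize x p.2 = e
      revert a b c d e
      decide
    · intro p hp
      by_cases h : M p.1 p.2 + (σ p.1 + σ p.2) = 1
      · rw [if_pos (mem_filter.2 ⟨hp, h⟩), h]
      · rw [if_neg (fun h' : p ∈ E' => h (mem_filter.1 h').2)]
        exact (zmod_two_cases _).resolve_right h
    · intro p hp
      have hp' : p.1 < p.2 := (mem_filter.1 hp).2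
      have : (p.2, p.1) ∉ E := fun h => lt_asymm hp' (hE _ h)
      simp [M, this]
  rw [e]
  refine Impl.mul (Impl.czPhase_of_degree_le (by simp) ?_ _ ?_)
    ((Impl.cutPhase ?_ ?_ ?_).mono (subset_univ _) le_rfl)
  · exact fun u v h h' => lt_asymm (hlt _ h) (hlt _ h')
  · intro v
    have h := hσ v
    rw [SimpleGraph.complete_graph_degree, Fintype.card_fin] at h
    refine (card_le_card (t := univ.filter fun u => (⊤ : SimpleGraph (Fin n)).Adj v u ∧
      M v u + (σ v + σ u) = 1) fun u hu => ?_).trans (by omega)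
    simp only [mem_filter, mem_univ, true_and, SimpleGraph.top_adj] at hu ⊢
    rcases hu with hu | hu
    · exact ⟨(hlt _ hu).ne, (mem_filter.1 hu).2⟩
    · refine ⟨(hlt _ hu).ne', ?_⟩
      rw [hM v u, add_comm (σ v)]
      exact (mem_filter.1 hu).2
  · rw [disjoint_filter]
    intro k _ h h'
    rw [h] at h'
    exact one_ne_zero h'
  · exact (card_le_univ _).trans (by simp)
  · exact (card_le_univ _).trans (by simp)

/-- A bipartite graph with parts of at most `m` vertices takes about `m / 2` time steps. -/
theorem Impl.czPhase_bipartite_half {E : Finset (Fin n × Fin n)} {X Y : Finset (Fin n)}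
    (hXY : Disjoint X Y) (hE : E ⊆ X ×ˢ Y) {m : ℕ} (hX : X.card ≤ m) (hY : Y.card ≤ m) :
    Impl (X ∪ Y) (m / 2 + 1 + (2 * Nat.clog 2 m + 1)) (czPhase E) := by
  classical
  let M : Fin n → Fin n → ZMod 2 := fun u v => if (u, v) ∈ E ∨ (v, u) ∈ E then 1 else 0
  have hM : ∀ u v, M u v = M v u := fun u v => by simp only [M, or_comm]
  have hne : ∀ k ∈ X, k ∉ Y := fun k hk => disjoint_left.1 hXY hk
  have hne' : ∀ k ∈ Y, k ∉ X := fun k hk => disjoint_right.1 hXY hk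
  let K : SimpleGraph (Fin n) :=
    { Adj := fun u v => (u ∈ X ∧ v ∈ Y) ∨ (u ∈ Y ∧ v ∈ X)
      symm := ⟨fun u v h => by tauto⟩
      loopless := ⟨fun u h => by have := hne u; tauto⟩ }
  obtain ⟨σ, hσ⟩ := exists_switching K M hM
  let E' := (X ×ˢ Y).filter fun p => M p.1 p.2 + (σ p.1 + σ p.2) = 1
  have hmem : ∀ p ∈ E', p.1 ∈ X ∧ p.2 ∈ Y := fun p hp => mem_product.1 (mem_filter.1 hp).1
  let X₁ := X.filter fun k => σ k = 1
  let X₀ := X.filter fun k => σ k = 0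
  let Y₁ := Y.filter fun k => σ k = 1
  let Y₀ := Y.filter fun k => σ k = 0
  -- The part of the cut that lies between `X` and `Y` consists of two complete bipartite graphs on
  -- disjoint vertex sets; their phases are executed in parallel.
  have e : CliffordDepth.czPhase E = CliffordDepth.czPhase E' *
      (CliffordDepth.cutPhase X₁ Y₀ * CliffordDepth.cutPhase X₀ Y₁) := by
    rw [CliffordDepth.czPhase, CliffordDepth.czPhase, CliffordDepth.cutPhase,
      CliffordDepth.cutPhase, dg_mul_dg, dg_mul_dg]
    congr 1; funext x
    rw [← sgn_add, ← sgn_add, sum_filter_eq_one, sum_filter_eq_zero, sum_filter_eq_one,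
      sum_filter_eq_zero, sum_mul_sum, sum_mul_sum, ← sum_product', ← sum_product',
      sum_edges_eq (X ×ˢ Y) E hE (fun p => M p.1 p.2) ?_,
      sum_edges_eq (X ×ˢ Y) E' (filter_subset _ _) (fun p => M p.1 p.2 + (σ p.1 + σ p.2)) ?_]
    · congr 1
      rw [← sum_add_distrib, ← sum_add_distrib]
      refine sum_congr rfl fun p _ => ?_
      generalize M p.1 p.2 = a
      generalize σ p.1 = b
      generalize σ p.2 = c
      generalize x p.1 = d
      generalize x p.2 = e
      revert a b c d e
      decide
    · intro p hp
      by_cases h : M p.1 p.2 + (σ p.1 + σ p.2) = 1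
      · rw [if_pos (mem_filter.2 ⟨hp, h⟩), h]
      · rw [if_neg (fun h' : p ∈ E' => h (mem_filter.1 h').2)]
        exact (zmod_two_cases _).resolve_right h
    · intro p hp
      have hp' := mem_product.1 hp
      have : (p.2, p.1) ∉ E := fun h => hne' _ hp'.2 (mem_product.1 (hE h)).1
      simp [M, this]
  have hd : ∀ S T, S ⊆ X → T ⊆ Y → Disjoint S T := fun S T hS hT =>
    (hXY.mono_left hS).mono_right hT
  have h10 : ∀ Z : Finset (Fin n), Disjoint (Z.filter fun k => σ k = 1)
      (Z.filter fun k => σ k = 0) := by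
    intro Z
    rw [disjoint_filter]
    intro k _ h h'
    rw [h] at h'
    exact one_ne_zero h'
  rw [e]
  refine Impl.mul (Impl.czPhase_of_degree_le (fun p hp => ⟨mem_union_left _ (hmem p hp).1,
    mem_union_right _ (hmem p hp).2⟩) ?_ _ ?_)
    (((Impl.cutPhase (m := m) ?_ ?_ ?_).mul_disjoint ?_ (Impl.cutPhase (m := m) ?_ ?_ ?_)).mono
      ?_ le_rfl)
  · exact fun u v h h' => hne' _ (hmem _ h).2 (hmem _ h').1
  · intro v
    have h := hσ v
    have hdeg : K.degree v ≤ m := by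
      rw [← SimpleGraph.card_neighborFinset_eq_degree]
      by_cases hv : v ∈ X
      · refine (card_le_card fun u hu => ?_).trans hY
        rcases (K.mem_neighborFinset v u).1 hu with h | h
        exacts [h.2, absurd h.1 (hne v hv)]
      · refine (card_le_card fun u hu => ?_).trans hX
        rcases (K.mem_neighborFinset v u).1 hu with h | h
        exacts [absurd h.1 hv, h.2]
    refine (card_le_card (t := univ.filter fun u => K.Adj v u ∧
      M v u + (σ v + σ u) = 1) fun u hu => ?_).trans (by omega)
    simp only [mem_filter, mem_univ, true_and] at hu ⊢
    rcases hu with hu | hu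
    · exact ⟨Or.inl (hmem _ hu), (mem_filter.1 hu).2⟩
    · refine ⟨Or.inr (hmem _ hu).symm, ?_⟩
      rw [hM v u, add_comm (σ v)]
      exact (mem_filter.1 hu).2
  · exact hd _ _ (filter_subset _ _) (filter_subset _ _)
  · exact (card_filter_le _ _).trans hX
  · exact (card_filter_le _ _).trans hY
  · rw [disjoint_union_left, disjoint_union_right, disjoint_union_right]
    exact ⟨⟨h10 X, hd _ _ (filter_subset _ _) (filter_subset _ _)⟩,
      (hd _ _ (filter_subset _ _) (filter_subset _ _)).symm, (h10 Y).symm⟩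
  · exact hd _ _ (filter_subset _ _) (filter_subset _ _)
  · exact (card_filter_le _ _).trans hX
  · exact (card_filter_le _ _).trans hY
  · refine union_subset (union_subset_union ?_ ?_) (union_subset_union ?_ ?_) <;>
      exact filter_subset _ _

/-! ### Linear maps -/

/-- The one-qubit identity `H Z^b H = X^b`. -/
theorem hm_sgn_hm (a b c : ZMod 2) :
    ∑ d, hm a d * sgn (d * b) * hm d c = if a = c + b then 1 else 0 := by
  rw [sum_zmod_two]
  have h := sqrt_two_inv_sq
  rcases zmod_two_cases a with rfl | rfl <;> rcases zmod_two_cases b with rfl | rfl <;>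
    rcases zmod_two_cases c with rfl | rfl <;> simp [hm, zmod_two_add_self] <;>
    linear_combination 2 * h

/-- Conjugation by Hadamard gates turns phases that are linear in the bits in `Y` into additions
to these bits. -/
theorem had_dg_had (Y : Finset (Fin n)) (b : Bits n → Bits n)
    (hb : ∀ x w : Bits n, (∀ k ∉ Y, x k = w k) → b x = b w) :
    had Y * (dg fun x => sgn (∑ k ∈ Y, x k * b x k)) * had Y =
      fn fun x k => if k ∈ Y then x k + b x k else x k := by
  ext x z
  let h : Fin n → Matrix (ZMod 2) (ZMod 2) ℂ := fun k => if k ∈ Y then hm else 1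
  have e1 : (had Y * (dg fun x => sgn (∑ k ∈ Y, x k * b x k)) * had Y) x z =
      ∑ w : Bits n, ∏ k, (h k (x k) (w k) * (if k ∈ Y then sgn (w k * b x k) else 1) *
        h k (w k) (z k)) := by
    rw [Matrix.mul_apply]
    refine sum_congr rfl fun w _ => ?_
    rw [dg, Matrix.mul_diagonal, prod_mul_distrib, prod_mul_distrib]
    by_cases hw : ∀ k ∉ Y, x k = w k
    · rw [← hb x w hw, sgn_sum, ← prod_filter]
      simp [had, tens, h]
    · push Not at hw
      obtain ⟨k, hk, hne⟩ := hw
      have h0 : ∏ k, h k (x k) (w k) = 0 := by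
        refine prod_eq_zero (mem_univ k) ?_
        simp [h, hk, hne]
      have h0' : had Y x w = 0 := h0
      rw [h0, h0', zero_mul, zero_mul, zero_mul, zero_mul]
  rw [e1, ← Fintype.piFinset_univ, ← prod_univ_sum (fun _ => univ)
    (fun k a => h k (x k) a * (if k ∈ Y then sgn (a * b x k) else 1) * h k a (z k))]
  have e2 : ∀ k, ∑ a, (h k (x k) a * (if k ∈ Y then sgn (a * b x k) else 1) * h k a (z k)) =
      if x k = (if k ∈ Y then z k + b x k else z k) then 1 else 0 := by
    intro k
    by_cases hk : k ∈ Y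
    · simp only [h, hk, if_true]
      exact hm_sgn_hm _ _ _
    · simp [h, hk, Matrix.one_apply]
  rw [prod_congr rfl fun k _ => e2 k, fn, Matrix.of_apply]
  by_cases hx : ∀ k ∉ Y, x k = z k
  · rw [← hb x z hx]
    by_cases hall : x = fun k => if k ∈ Y then z k + b x k else z k
    · rw [if_pos hall, prod_eq_one]
      intro k _
      rw [if_pos (congrFun hall k)]
    · rw [if_neg hall]
      obtain ⟨k, hk⟩ := Function.ne_iff.1 hall
      exact prod_eq_zero (mem_univ k) (if_neg hk)
  · push Not at hx
    obtain ⟨k, hk, hne⟩ := hx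
    rw [prod_eq_zero (mem_univ k) (by simp [hk, hne]), if_neg]
    intro h
    have := congrFun h k
    simp only [hk, if_false] at this
    exact hne this

end CliffordDepth

namespace CliffordDepth

open Finset Matrix

variable {n : ℕ}

/-- The operator `|x⟩ ↦ |A x⟩` of a matrix `A`. -/
def lin (A : Matrix (Fin n) (Fin n) (ZMod 2)) : Op n := fn fun x => A *ᵥ x

theorem lin_mul (A B : Matrix (Fin n) (Fin n) (ZMod 2)) : lin (A * B) = lin A * lin B := by
  rw [lin, lin, lin, fn_mul_fn]
  simp only [Matrix.mulVec_mulVec]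

theorem lin_one : lin (1 : Matrix (Fin n) (Fin n) (ZMod 2)) = 1 := by
  simp only [lin, Matrix.one_mulVec]
  exact fn_id

/-! ### Triangular matrices -/

/-- Bipartite CZ circuits with parts of at most `m` vertices take at most `b` time steps. -/
def BipartiteBound (m b : ℕ) : Prop :=
  ∀ (n : ℕ) (X Y : Finset (Fin n)) (E : Finset (Fin n × Fin n)), Disjoint X Y → E ⊆ X ×ˢ Y →
    X.card ≤ m → Y.card ≤ m → Impl (X ∪ Y) b (czPhase E)

/-- Unitriangular matrices that act on at most `m` bits take at most `d` time steps. -/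
def TriangularBound (m d : ℕ) : Prop :=
  ∀ (n : ℕ) (S : Finset (Fin n)) (A : Matrix (Fin n) (Fin n) (ZMod 2)), S.card ≤ m →
    (∀ i, A i i = 1) → (∀ i j, i < j → A i j = 0) →
    (∀ i j, i ≠ j → ¬ (i ∈ S ∧ j ∈ S) → A i j = 0) → Impl S d (lin A)

theorem bipartiteBound_self (m : ℕ) : BipartiteBound m m :=
  fun _ _ _ _ hXY hE hX hY => Impl.czPhase_bipartite hXY hE hX hY

theorem bipartiteBound_half (m : ℕ) :
    BipartiteBound m (m / 2 + 1 + (2 * Nat.clog 2 m + 1)) :=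
  fun _ _ _ _ hXY hE hX hY => Impl.czPhase_bipartite_half hXY hE hX hY

/-- Hadamard gates on `Y` turn the CZ gates between `X` and `Y` into CNOT gates with targets in `Y`.
All of these commute, since no bit of `X` is a target. -/
theorem BipartiteBound.lin {m b : ℕ} (h : BipartiteBound m b) {X Y : Finset (Fin n)}
    (hXY : Disjoint X Y) (hX : X.card ≤ m) (hY : Y.card ≤ m)
    (C : Matrix (Fin n) (Fin n) (ZMod 2)) (hC : ∀ i j, ¬ (i ∈ Y ∧ j ∈ X) → C i j = 0) :
    Impl (X ∪ Y) b (lin (1 + C)) := by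
  let E : Finset (Fin n × Fin n) := (X ×ˢ Y).filter fun p => C p.2 p.1 = 1
  have hne : ∀ k ∈ X, k ∉ Y := fun k hk => disjoint_left.1 hXY hk
  have e : CliffordDepth.lin (1 + C) = had Y * czPhase E * had Y := by
    have e1 : czPhase E = dg fun x => sgn (∑ k ∈ Y, x k * (fun k => ∑ i ∈ X, C k i * x i) k) := by
      rw [czPhase]
      congr 1; funext x
      rw [sum_edges_eq (X ×ˢ Y) E (filter_subset _ _) (fun p => C p.2 p.1), sum_product_right]
      · congr 1
        refine sum_congr rfl fun k _ => ?_
        rw [mul_sum]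
        exact sum_congr rfl fun i _ => by ring
      · intro p hp
        by_cases hp1 : C p.2 p.1 = 1
        · rw [if_pos (mem_filter.2 ⟨hp, hp1⟩), hp1]
        · rw [if_neg (fun h' : p ∈ E => hp1 (mem_filter.1 h').2)]
          exact (zmod_two_cases _).resolve_right hp1
    rw [e1, had_dg_had Y (fun x k => ∑ i ∈ X, C k i * x i), CliffordDepth.lin]
    · congr 1; funext x k
      rw [Matrix.add_mulVec, Matrix.one_mulVec, Pi.add_apply, Matrix.mulVec, dotProduct]
      split_ifs with hk
      · congr 1
        refine (sum_subset (subset_univ X) fun i _ hi => ?_).symm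
        rw [hC k i (fun h => hi h.2), zero_mul]
      · rw [sum_eq_zero, add_zero]
        intro i _
        rw [hC k i (fun h => hk h.1), zero_mul]
    · intro x w hxw
      funext k
      exact sum_congr rfl fun i hi => by rw [hxw i (hne i hi)]
  rw [e]
  exact (Impl.free_mul (Impl.had Y) (h _ X Y E hXY (filter_subset _ _) hX hY)).mul_free
    (Impl.had Y)

/-- Cut `S` by rank, so that the parts respect the order and a triangular matrix has no entries with
row in `X` and column in `Y`. -/
theorem exists_lower_half {m : ℕ} (S : Finset (Fin n)) (hS : S.card ≤ 2 * m) :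
    ∃ X Y : Finset (Fin n), Disjoint X Y ∧ X ∪ Y = S ∧ X.card ≤ m ∧ Y.card ≤ m ∧
      ∀ i ∈ X, ∀ j ∈ Y, i < j := by
  let rk : Fin n → ℕ := fun i => (S.filter (· < i)).card
  have hlt : ∀ i ∈ S, ∀ j, i < j → rk i < rk j := by
    intro i hi j hij
    refine card_lt_card ⟨fun k hk => ?_, fun h => ?_⟩
    · rw [mem_filter] at hk ⊢
      exact ⟨hk.1, hk.2.trans hij⟩
    · have := h (mem_filter.2 ⟨hi, hij⟩)
      exact lt_irrefl _ (mem_filter.1 this).2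
  have hinj : ∀ i ∈ S, ∀ j ∈ S, rk i = rk j → i = j := by
    intro i hi j hj hij
    rcases lt_trichotomy i j with h | h | h
    · exact absurd hij (hlt i hi j h).ne
    · exact h
    · exact absurd hij (hlt j hj i h).ne'
  have hrk : ∀ i ∈ S, rk i < S.card := fun i hi => card_lt_card
    ⟨filter_subset _ _, fun h => lt_irrefl _ (mem_filter.1 (h hi)).2⟩
  refine ⟨S.filter fun i => rk i < m, S.filter fun i => ¬ rk i < m,
    disjoint_filter_filter_not _ _ _, filter_union_filter_not_eq _ _, ?_, ?_, ?_⟩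
  · refine (card_le_card_of_injOn rk (t := range m) (fun i hi => ?_) fun i hi j hj => ?_).trans_eq
      (card_range m)
    · rw [mem_coe, mem_filter] at hi
      simpa using hi.2
    · exact hinj i (mem_filter.1 hi).1 j (mem_filter.1 hj).1
  · refine (card_le_card_of_injOn rk (t := Ico m (2 * m)) (fun i hi => ?_)
      fun i hi j hj => ?_).trans_eq ?_
    · rw [mem_coe, mem_filter] at hi
      have := hrk i hi.1
      simp only [coe_Ico, Set.mem_Ico]
      omega
    · exact hinj i (mem_filter.1 hi).1 j (mem_filter.1 hj).1
    · rw [Nat.card_Ico]; omega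
  · intro i hi j hj
    rw [mem_filter] at hi hj
    by_contra hij
    rcases (not_lt.1 hij).eq_or_lt with h | h
    · rw [h] at hj; exact hj.2 hi.2
    · have := hlt j hj.1 i h
      omega

theorem det_of_unitriangular {A : Matrix (Fin n) (Fin n) (ZMod 2)} (h1 : ∀ i, A i i = 1)
    (h0 : ∀ i j, i < j → A i j = 0) : A.det = 1 := by
  rw [Matrix.det_of_isLowerTriangular A fun i j hij => h0 i j (by simpa using hij)]
  exact prod_eq_one fun i _ => h1 i

/-- Factor the matrix as (diagonal blocks) times (off-diagonal block). The diagonal blocks act on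
disjoint sets and run in parallel in depth `d`; the remaining block is bipartite and takes depth
`b`. -/
theorem TriangularBound.step {m d b s : ℕ} (h : TriangularBound m d) (hb : BipartiteBound m b)
    (hs : s ≤ 2 * m) : TriangularBound s (d + b) := by
  intro n S A hS h1 h0 hA
  obtain ⟨X, Y, hXY, rfl, hX, hY, hlt⟩ := exists_lower_half (m := m) S (hS.trans hs)
  let D : Finset (Fin n) → Matrix (Fin n) (Fin n) (ZMod 2) := fun Z =>
    Matrix.of fun i j => if i ∈ Z ∧ j ∈ Z ∧ i ≠ j then A i j else 0
  let B : Matrix (Fin n) (Fin n) (ZMod 2) :=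
    Matrix.of fun i j => if i ∈ Y ∧ j ∈ X then A i j else 0
  have hne : ∀ k ∈ X, k ∉ Y := fun k hk => disjoint_left.1 hXY hk
  have hXD : ∀ M : Matrix (Fin n) (Fin n) (ZMod 2), (∀ i j, i ∉ Y → M i j = 0) → D X * M = 0 := by
    intro M hM
    ext i j
    rw [Matrix.mul_apply, Matrix.zero_apply]
    refine sum_eq_zero fun k _ => ?_
    by_cases hk : k ∈ X
    · rw [hM k j (hne k hk), mul_zero]
    · simp [D, hk]
  have hunit : ∀ Z i, (1 + D Z) i i = 1 := fun Z i => by simp [D]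
  have hlow : ∀ Z i j, i < j → (1 + D Z) i j = 0 := fun Z i j hij => by
    simp [D, Matrix.one_apply_ne hij.ne, h0 i j hij]
  have hoff : ∀ Z i j, i ≠ j → ¬ (i ∈ Z ∧ j ∈ Z) → (1 + D Z) i j = 0 := fun Z i j hij hZ => by
    have : ¬ (i ∈ Z ∧ j ∈ Z ∧ i ≠ j) := fun h => hZ ⟨h.1, h.2.1⟩
    simp [D, Matrix.one_apply_ne hij, this]
  have hdet : IsUnit (1 + D Y).det := by
    rw [det_of_unitriangular (hunit Y) (hlow Y)]; exact isUnit_one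
  -- The lower block `B` is divided by the diagonal block of `Y`, because in the product the
  -- off-diagonal factor acts before the diagonal ones.
  let C := (1 + D Y)⁻¹ * B
  have hC : (1 + D Y) * C = B := Matrix.mul_nonsing_inv_cancel_left _ _ hdet
  have hCB : ∀ i j, ¬ (i ∈ Y ∧ j ∈ X) → C i j = 0 := by
    intro i j hij
    by_cases hj : j ∈ X
    · have hi : i ∉ Y := fun hi => hij ⟨hi, hj⟩
      have e := congrFun (congrFun hC i) j
      rw [add_mul, one_mul, Matrix.add_apply, Matrix.mul_apply, sum_eq_zero, add_zero] at e
      · rw [e]; simp [B, hi]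
      · intro k _
        simp [D, hi]
    · change ((1 + D Y)⁻¹ * B) i j = 0
      rw [Matrix.mul_apply]
      exact sum_eq_zero fun k _ => by simp [B, hj]
  have e : A = (1 + D X) * (1 + D Y) * (1 + C) := by
    rw [mul_assoc, mul_add, hC, mul_one, add_mul, one_mul, mul_add, mul_add, mul_one,
      hXD (D Y) fun i j hi => by simp [D, hi], hXD B fun i j hi => by simp [B, hi]]
    ext i j
    simp only [Matrix.add_apply, Matrix.zero_apply, D, B, Matrix.of_apply]
    by_cases hij : i = j
    · subst hij
      have : ¬ (i ∈ Y ∧ i ∈ X) := fun h => hne i h.2 h.1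
      simp [h1, this]
    · rw [Matrix.one_apply_ne hij]
      by_cases hi : i ∈ X
      · have hi' := hne i hi
        by_cases hj : j ∈ X
        · simp [hi, hj, hij, hi']
        · by_cases hj' : j ∈ Y
          · simp [hj, hi', h0 i j (hlt i hi j hj')]
          · simp [hj, hi', hA i j hij (by simp [hj, hj'])]
      · by_cases hi' : i ∈ Y
        · by_cases hj : j ∈ X
          · simp [hi, hj, hi', hne j hj]
          · by_cases hj' : j ∈ Y
            · simp [hi, hj, hi', hj', hij]
            · simp [hj, hj', hA i j hij (by simp [hj, hj'])]
        · simp [hi, hi', hA i j hij (by simp [hi, hi'])]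
  rw [e, lin_mul, lin_mul]
  exact ((h n X _ hX (hunit X) (hlow X) (hoff X)).mul_disjoint hXY
    (h n Y _ hY (hunit Y) (hlow Y) (hoff Y))).mul (hb.lin hXY hX hY C hCB)

theorem triangularBound_one : TriangularBound 1 0 := by
  intro n S A hS h1 _ hA
  have : A = 1 := by
    ext i j
    by_cases hij : i = j
    · subst hij; rw [h1, Matrix.one_apply_eq]
    · rw [Matrix.one_apply_ne hij, hA i j hij]
      rintro ⟨hi, hj⟩
      exact hij (card_le_one.1 hS i hi j hj)
  rw [this, lin_one]
  exact Impl.one.mono (empty_subset _) le_rfl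

theorem TriangularBound.mono {m m' d d' : ℕ} (h : TriangularBound m d) (hm : m' ≤ m)
    (hd : d ≤ d') : TriangularBound m' d' :=
  fun n S A hS h1 h0 hA => (h n S A (hS.trans hm) h1 h0 hA).mono subset_rfl hd

theorem TriangularBound.double {m d s : ℕ} (h : TriangularBound m d) (hs : s ≤ 2 * m) :
    TriangularBound s (d + m) :=
  h.step (bipartiteBound_self m) hs

/-- For `n ≤ 2 ^ k`, triangular matrices of size `n` take at most
`(n + 2 k ^ 2 + 3 k - 34) / 2` time steps. -/
theorem triangularBound_pow (k : ℕ) (n : ℕ) (hn : n ≤ 2 ^ (k + 5)) :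
    ∃ d, 2 * d + 34 ≤ n + 2 * (k + 5) ^ 2 + 3 * (k + 5) ∧ TriangularBound n d := by
  induction k generalizing n with
  | zero =>
    -- Plain doubling costs `1 + 2 + 4 + 8`. Switching is used only for larger blocks, where the
    -- logarithmic overhead pays.
    have h16 : TriangularBound 16 15 :=
      (((triangularBound_one.double (s := 2) (by norm_num)).double (s := 4) (by norm_num)).double
        (s := 8) (by norm_num)).double (s := 16) (by norm_num)
    have hn' : n ≤ 32 := by simpa using hn
    exact ⟨15 + (n + 1) / 2, by omega,
      (h16.mono (m' := (n + 1) / 2) (by omega) le_rfl).double (by omega)⟩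
  | succ k ih =>
    have hm : (n + 1) / 2 ≤ 2 ^ (k + 5) := by
      rw [show k + 1 + 5 = (k + 5) + 1 by ring, pow_succ] at hn
      omega
    obtain ⟨d, hd, h⟩ := ih _ hm
    have hl : Nat.clog 2 ((n + 1) / 2) ≤ k + 5 := Nat.clog_le_of_le_pow hm
    -- With `K = k + 5`, one halving adds at most `4K + 5` to twice the depth beyond the linear
    -- term; this is exactly the increment of `2K² + 3K`. The constant `34` makes the base case
    -- tight.
    refine ⟨_, ?_, h.step (bipartiteBound_half _) (s := n) (by omega)⟩
    have e : (k + 1 + 5) ^ 2 = (k + 5) ^ 2 + 2 * (k + 5) + 1 := by ring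
    rw [e]
    generalize (k + 5) ^ 2 = q at hd ⊢
    generalize Nat.clog 2 ((n + 1) / 2) = l at hl ⊢
    omega

/-! ### Permutations -/

theorem Impl.swap {i j : Fin n} (hij : i ≠ j) :
    Impl {i, j} 3 (fn fun x k => if k = i then x j else if k = j then x i else x k) := by
  have e : (fn fun x k => if k = i then x j else if k = j then x i else x k) =
      fn (addBit i j) * fn (addBit j i) * fn (addBit i j) := by
    rw [fn_mul_fn, fn_mul_fn]
    congr 1; funext x k
    have h2 := zmod_two_add_self (x i)
    have h3 := zmod_two_add_self (x j)
    simp only [addBit, Function.update_apply, hij, hij.symm, if_true, if_false]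
    by_cases hk : k = i
    · subst hk
      simp only [hij, if_true, if_false]
      linear_combination -h2
    · by_cases hk' : k = j
      · subst hk'
        simp only [hk, if_true, if_false]
        linear_combination -h3 -h2
      · simp [hk, hk']
  rw [e]
  exact ((Impl.CNOT hij).mul (by rw [pair_comm]; exact Impl.CNOT hij.symm)).mul (Impl.CNOT hij)

/-- An involution is a product of disjoint transpositions, each made of three CNOT gates; they run
in parallel. -/
theorem Impl.involution (τ : Fin n → Fin n) (hτ : ∀ k, τ (τ k) = k) (A : Finset (Fin n))
    (hA : ∀ k ∈ A, τ k ∈ A) : Impl A 3 (fn fun x k => if k ∈ A then x (τ k) else x k) := by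
  induction hc : A.card using Nat.strong_induction_on generalizing A with
  | _ m ih =>
  by_cases hfix : ∀ k ∈ A, τ k = k
  · have : (fn fun (x : Bits n) k => if k ∈ A then x (τ k) else x k) = 1 := by
      rw [← fn_id]
      congr 1; funext x k
      split_ifs with hk
      · rw [hfix k hk]
      · rfl
    rw [this]
    exact Impl.one.mono (empty_subset _) (Nat.zero_le _)
  · push Not at hfix
    obtain ⟨i, hi, hne⟩ := hfix
    have hsub : ({i, τ i} : Finset (Fin n)) ⊆ A := by
      intro k hk
      simp only [mem_insert, mem_singleton] at hk
      rcases hk with rfl | rfl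
      exacts [hi, hA _ hi]
    have hτinj : Function.Injective τ := fun a b h => by rw [← hτ a, h, hτ]
    have hA' : ∀ k ∈ A \ {i, τ i}, τ k ∈ A \ {i, τ i} := by
      intro k hk
      simp only [mem_sdiff, mem_insert, mem_singleton, not_or] at hk ⊢
      refine ⟨hA k hk.1, fun h => hk.2.2 ?_, fun h => hk.2.1 (hτinj h)⟩
      rw [← h, hτ]
    have e : (fn fun (x : Bits n) k => if k ∈ A then x (τ k) else x k) =
        (fn fun x k => if k ∈ A \ {i, τ i} then x (τ k) else x k) *
        (fn fun x k => if k = i then x (τ i) else if k = τ i then x i else x k) := by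
      rw [fn_mul_fn]
      congr 1; funext x k
      have h1 := hA i hi
      have h2 := hτ i
      have h3 : τ k = i → k = τ i := fun h => by rw [← h, hτ]
      have h4 : τ k = τ i → k = i := fun h => hτinj h
      simp only [mem_sdiff, mem_insert, mem_singleton, not_or]
      grind
    have hlt : (A \ {i, τ i}).card < m := by
      rw [← hc]
      exact card_lt_card ⟨sdiff_subset, fun h => by simpa using h hi⟩
    rw [e]
    exact ((ih _ hlt _ hA' rfl).mul_disjoint sdiff_disjoint (Impl.swap hne.symm)).mono
      (sdiff_union_of_subset hsub).le le_rfl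

/-- Every permutation is a product of two involutions. -/
theorem exists_involutions {V : Type*} (π : Equiv.Perm V) :
    ∃ τ ρ : V → V, (∀ x, τ (τ x) = x) ∧ (∀ x, ρ (ρ x) = x) ∧ ∀ x, π x = τ (ρ x) := by
  classical
  let s := Equiv.Perm.SameCycle.setoid π
  let r : V → V := fun x => (Quotient.mk s x).out
  have hr : ∀ x, ∃ k : ℤ, (π ^ k) (r x) = x := fun x => Quotient.mk_out (s := s) x
  have hrr : ∀ x (k : ℤ), r ((π ^ k) x) = r x := by
    intro x k
    have : Quotient.mk s ((π ^ k) x) = Quotient.mk s x :=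
      Quotient.sound (s := s) (show π.SameCycle _ _ from ⟨-k, by simp⟩)
    simp only [r, this]
  choose e he using hr
  -- On each cycle `τ` is the reflection about the chosen representative. A rotation composed with a
  -- reflection is again a reflection, so `τ ∘ π` is an involution too.
  let τ : V → V := fun x => (π ^ (-e x)) (r x)
  -- The exponent `e x` is determined only modulo the cycle length; this shows that the reflection
  -- does not depend on its choice.
  have hinv : ∀ x (a b : ℤ), (π ^ a) x = (π ^ b) x → (π ^ (-a)) x = (π ^ (-b)) x := by
    intro x a b h
    have h' := congrArg (π ^ (-a - b)) h
    rw [← Equiv.Perm.mul_apply, ← Equiv.Perm.mul_apply, ← _root_.zpow_add, ← _root_.zpow_add] at h'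
    rw [show -a - b + a = -b by ring, show -a - b + b = -a by ring] at h'
    exact h'.symm
  have hτ : ∀ x (k : ℤ), τ ((π ^ k) (r x)) = (π ^ (-k)) (r x) := by
    intro x k
    have h1 : r ((π ^ k) (r x)) = r x := by
      rw [hrr]
      conv_rhs => rw [← he x]
      rw [hrr]
    have h2 := he ((π ^ k) (r x))
    simp only [τ]
    rw [h1] at h2 ⊢
    exact hinv _ _ _ h2
  have hτπ : ∀ x, τ (π x) = (π ^ (-(e x + 1))) (r x) := by
    intro x
    rw [← hτ, add_comm, _root_.zpow_add, Equiv.Perm.mul_apply, he, zpow_one]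
  have hττ : ∀ x, τ (τ x) = x := by
    intro x
    change τ ((π ^ (-e x)) (r x)) = x
    rw [hτ, neg_neg, he]
  refine ⟨τ, fun x => τ (π x), hττ, fun x => ?_, fun x => (hττ _).symm⟩
  change τ (π (τ (π x))) = x
  rw [hτπ x]
  have : π ((π ^ (-(e x + 1))) (r x)) = (π ^ (-e x)) (r x) := by
    rw [← Equiv.Perm.mul_apply, ← _root_.zpow_one_add]
    congr 2; ring
  rw [this, hτ, neg_neg, he]

theorem Impl.perm (π : Equiv.Perm (Fin n)) :
    Impl univ 6 (fn fun (x : Bits n) k => x (π k)) := by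
  obtain ⟨τ, ρ, hτ, hρ, h⟩ := exists_involutions π
  have e : (fn fun (x : Bits n) k => x (π k)) =
      (fn fun x k => if k ∈ univ then x (ρ k) else x k) *
      (fn fun x k => if k ∈ univ then x (τ k) else x k) := by
    rw [fn_mul_fn]
    simp [h]
  rw [e]
  exact (Impl.involution ρ hρ univ (by simp)).mul (Impl.involution τ hτ univ (by simp))

end CliffordDepth

namespace CliffordDepth

open Finset

variable {n : ℕ}

/-! ### Quadratic phases -/

/-- Pairs of bit strings, the index set of the entries of an operator. -/
abbrev Bits₂ (n : ℕ) : Type := Bits n × Bits n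

/-- The primitive eighth root of unity. -/
noncomputable def omega8 : ℂ := ((Real.sqrt 2 : ℝ) : ℂ)⁻¹ * (1 + Complex.I)

theorem omega8_sq : omega8 * omega8 = Complex.I := by
  unfold omega8
  linear_combination (1 + Complex.I) ^ 2 * sqrt_two_inv_sq + (1 / 2 : ℂ) * Complex.I_sq

/-- Affine functions. -/
def IsAff (l : Bits₂ n → ZMod 2) : Prop :=
  ∃ (f : Bits₂ n →ₗ[ZMod 2] ZMod 2) (c : ZMod 2), ∀ z, l z = f z + c

theorem IsAff.linear (f : Bits₂ n →ₗ[ZMod 2] ZMod 2) : IsAff fun z => f z := ⟨f, 0, by simp⟩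

theorem IsAff.const (c : ZMod 2) : IsAff fun _ : Bits₂ n => c := ⟨0, c, by simp⟩

theorem IsAff.add {l m : Bits₂ n → ZMod 2} (hl : IsAff l) (hm : IsAff m) :
    IsAff fun z => l z + m z := by
  obtain ⟨f, c, hf⟩ := hl
  obtain ⟨g, d, hg⟩ := hm
  exact ⟨f + g, c + d, fun z => by simp [hf, hg]; ring⟩

theorem IsAff.comp {l : Bits₂ n → ZMod 2} (hl : IsAff l) (A : Bits₂ n →ₗ[ZMod 2] Bits₂ n) :
    IsAff fun z => l (A z) := by
  obtain ⟨f, c, hf⟩ := hl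
  exact ⟨f ∘ₗ A, c, fun z => by simp [hf]⟩

theorem IsAff.fst (i : Fin n) : IsAff fun z : Bits₂ n => z.1 i :=
  IsAff.linear (LinearMap.proj i ∘ₗ LinearMap.fst _ _ _)

theorem IsAff.snd (i : Fin n) : IsAff fun z : Bits₂ n => z.2 i :=
  IsAff.linear (LinearMap.proj i ∘ₗ LinearMap.snd _ _ _)

/-- The quadratic phases. -/
noncomputable def quadPhase (n : ℕ) : Submonoid (Bits₂ n → ℂ) :=
  Submonoid.closure ({fun _ => omega8} ∪
    Set.range fun (f : Bits₂ n →ₗ[ZMod 2] ZMod 2) => fun z => iota (f z))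

theorem quadPhase_omega8 : (fun _ => omega8) ∈ quadPhase n :=
  Submonoid.subset_closure (Or.inl rfl)

theorem quadPhase_linear (f : Bits₂ n →ₗ[ZMod 2] ZMod 2) : (fun z => iota (f z)) ∈ quadPhase n :=
  Submonoid.subset_closure (Or.inr ⟨f, rfl⟩)

theorem quadPhase_mul {f g : Bits₂ n → ℂ} (hf : f ∈ quadPhase n) (hg : g ∈ quadPhase n) :
    (fun z => f z * g z) ∈ quadPhase n := (quadPhase n).mul_mem hf hg

theorem quadPhase_I : (fun _ => Complex.I) ∈ quadPhase n := by
  have := quadPhase_mul (quadPhase_omega8 (n := n)) quadPhase_omega8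
  simpa only [omega8_sq] using this

theorem quadPhase_aff {l : Bits₂ n → ZMod 2} (hl : IsAff l) : (fun z => iota (l z)) ∈ quadPhase n := by
  obtain ⟨f, c, hf⟩ := hl
  rcases zmod_two_cases c with rfl | rfl
  · simpa [hf] using quadPhase_linear f
  · have := quadPhase_mul (quadPhase_mul (quadPhase_linear f) quadPhase_I)
      (quadPhase_mul (quadPhase_linear f) (quadPhase_linear f))
    convert this using 2 with z
    rw [hf, iota_add, iota_sq, mul_one, iota_one]

theorem quadPhase_sgn {l : Bits₂ n → ZMod 2} (hl : IsAff l) : (fun z => sgn (l z)) ∈ quadPhase n := by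
  have := quadPhase_mul (quadPhase_aff hl) (quadPhase_aff hl)
  simpa only [iota_sq] using this

/-- Polarization: the cocycle `sgn (l * m)` of `iota` is a product of values of `iota` and `sgn` at
`l`, `m` and `l + m`. -/
theorem quadPhase_sgn_mul {l m : Bits₂ n → ZMod 2} (hl : IsAff l) (hm : IsAff m) :
    (fun z => sgn (l z * m z)) ∈ quadPhase n := by
  have h1 := quadPhase_mul (quadPhase_aff (hl.add hm))
    (quadPhase_mul (quadPhase_aff hl) (quadPhase_aff hm))
  have h2 := quadPhase_mul h1 (quadPhase_sgn (hl.add hm))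
  convert h2 using 2 with z
  rw [iota_add, sgn_add]
  have e1 := iota_sq (l z)
  have e2 := iota_sq (m z)
  have e3 := sgn_mul_self (l z)
  have e4 := sgn_mul_self (m z)
  calc sgn (l z * m z) = (sgn (l z) * sgn (l z)) * (sgn (m z) * sgn (m z)) * sgn (l z * m z) := by
        rw [e3, e4]; ring
    _ = _ := by nth_rewrite 1 [← e1]; nth_rewrite 2 [← e2]; ring

theorem quadPhase_comp {f : Bits₂ n → ℂ} (hf : f ∈ quadPhase n)
    (A : Bits₂ n →ₗ[ZMod 2] Bits₂ n) : (fun z => f (A z)) ∈ quadPhase n := by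
  induction hf using Submonoid.closure_induction with
  | mem f hf =>
    rcases hf with rfl | ⟨g, rfl⟩
    · exact quadPhase_omega8
    · exact quadPhase_linear (g ∘ₗ A)
  | one => exact (quadPhase n).one_mem
  | mul f g _ _ hf hg => exact quadPhase_mul hf hg

/-- The row index bit `i` is set to `b`. -/
def setBit (i : Fin n) (b : ZMod 2) (z : Bits₂ n) : Bits₂ n := (Function.update z.1 i b, z.2)

@[simp] theorem setBit_fst_self (i : Fin n) (b : ZMod 2) (z : Bits₂ n) :
    (setBit i b z).1 i = b := by simp [setBit]

theorem setBit_fst_of_ne {i j : Fin n} (h : j ≠ i) (b : ZMod 2) (z : Bits₂ n) :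
    (setBit i b z).1 j = z.1 j := by simp [setBit, h]

@[simp] theorem setBit_setBit (i : Fin n) (b c : ZMod 2) (z : Bits₂ n) :
    setBit i b (setBit i c z) = setBit i b z := by simp [setBit]

@[simp] theorem setBit_self (i : Fin n) (z : Bits₂ n) : setBit i (z.1 i) z = z := by
  simp [setBit]

theorem setBit_comm {i j : Fin n} (h : i ≠ j) (b c : ZMod 2) (z : Bits₂ n) :
    setBit i b (setBit j c z) = setBit j c (setBit i b z) := by
  simp [setBit, Function.update_comm h]

/-- Setting a bit to zero is linear. -/
def setBitZero (i : Fin n) : Bits₂ n →ₗ[ZMod 2] Bits₂ n where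
  toFun := setBit i 0
  map_add' z w := by
    refine Prod.ext (funext fun k => ?_) rfl
    by_cases hk : k = i
    · subst hk; simp
    · simp [setBit, hk]
  map_smul' a z := by
    refine Prod.ext (funext fun k => ?_) rfl
    by_cases hk : k = i
    · subst hk; simp
    · simp [setBit, hk]

/-- The function `l` does not depend on the row index bit `i`. -/
def IndepBit (i : Fin n) (l : Bits₂ n → ZMod 2) : Prop := ∀ b z, l (setBit i b z) = l z

theorem setBit_eq_add (i : Fin n) (z : Bits₂ n) :
    z = setBit i 0 z + z.1 i • ((Pi.single i 1, 0) : Bits₂ n) := by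
  refine Prod.ext (funext fun k => ?_) (by simp [setBit])
  by_cases hk : k = i
  · subst hk; simp
  · simp [setBit, hk]

/-- The dependence of a quadratic phase on one bit. -/
theorem quadPhase_split {f : Bits₂ n → ℂ} (hf : f ∈ quadPhase n) (i : Fin n) :
    ∃ l, IsAff l ∧ IndepBit i l ∧ ((∀ z, f z = f (setBit i 0 z) * sgn (z.1 i * l z)) ∨
      ∀ z, f z = f (setBit i 0 z) * (iota (z.1 i) * sgn (z.1 i * l z))) := by
  induction hf using Submonoid.closure_induction with
  | mem f hf =>
    rcases hf with rfl | ⟨g, rfl⟩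
    · exact ⟨_, IsAff.const 0, fun _ _ => rfl, Or.inl (by simp)⟩
    · have hg : ∀ z, g z = g (setBit i 0 z) + z.1 i * g (Pi.single i 1, 0) := by
        intro z
        conv_lhs => rw [setBit_eq_add i z]
        rw [map_add, map_smul, smul_eq_mul]
      rcases zmod_two_cases (g (Pi.single i 1, 0)) with h | h
      · refine ⟨_, IsAff.const 0, fun _ _ => rfl, Or.inl fun z => ?_⟩
        dsimp only
        rw [hg, h]
        simp
      · refine ⟨fun z => g (setBitZero i z), (IsAff.linear g).comp _, fun b z => ?_,
          Or.inr fun z => ?_⟩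
        · change g (setBit i 0 (setBit i b z)) = g (setBit i 0 z)
          rw [setBit_setBit]
        · dsimp only
          rw [hg, h, mul_one, iota_add, mul_assoc, mul_comm (z.1 i)]
          rfl
  | one => exact ⟨_, IsAff.const 0, fun _ _ => rfl, Or.inl (by simp)⟩
  | mul f g _ _ hf hg =>
    obtain ⟨l, hl, hli, hf⟩ := hf
    obtain ⟨m, hm, hmi, hg⟩ := hg
    rcases hf with hf | hf <;> rcases hg with hg | hg
    · refine ⟨_, hl.add hm, fun b z => by simp only [hli b z, hmi b z], Or.inl fun z => ?_⟩
      rw [Pi.mul_apply, Pi.mul_apply, hf z, hg z, mul_add, sgn_add]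
      ring
    · refine ⟨_, hl.add hm, fun b z => by simp only [hli b z, hmi b z], Or.inr fun z => ?_⟩
      rw [Pi.mul_apply, Pi.mul_apply, hf z, hg z, mul_add, sgn_add]
      ring
    · refine ⟨_, hl.add hm, fun b z => by simp only [hli b z, hmi b z], Or.inr fun z => ?_⟩
      rw [Pi.mul_apply, Pi.mul_apply, hf z, hg z, mul_add, sgn_add]
      ring
    -- Two factors `iota (z.1 i)` combine to `sgn (z.1 i)`, which adds the constant `1` to the
    -- coefficient.
    · refine ⟨_, (hl.add hm).add (IsAff.const 1), fun b z => by simp only [hli b z, hmi b z],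
        Or.inl fun z => ?_⟩
      rw [Pi.mul_apply, Pi.mul_apply, hf z, hg z, mul_add, mul_add, sgn_add, sgn_add, mul_one,
        ← iota_sq (z.1 i)]
      ring

/-! ### Hadamard gates acting on functions -/

/-- The operator with the entries `f`. -/
def entries (f : Bits₂ n → ℂ) : Op n := Matrix.of fun x y => f (x, y)

/-- The action of a Hadamard gate on the entries of an operator. -/
noncomputable def hadBit (i : Fin n) (f : Bits₂ n → ℂ) : Bits₂ n → ℂ := fun z =>
  ((Real.sqrt 2 : ℝ) : ℂ)⁻¹ * (f (setBit i 0 z) + sgn (z.1 i) * f (setBit i 1 z))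

theorem dg_mul_entries (g : Bits n → ℂ) (f : Bits₂ n → ℂ) :
    dg g * entries f = entries fun z => g z.1 * f z := by
  ext x y
  simp [dg, entries, Matrix.diagonal_mul]

theorem had_mul_entries (i : Fin n) (f : Bits₂ n → ℂ) :
    had {i} * entries f = entries (hadBit i f) := by
  ext x y
  have hne : Function.update x i 0 ≠ Function.update x i 1 := by
    intro h
    have := congrFun h i
    simp at this
  have hprod : ∀ w : Bits n, (∀ k ≠ i, x k = w k) → had {i} x w = hm (x i) (w i) := by
    intro w hw
    rw [had, tens, Matrix.of_apply, ← mul_prod_erase _ _ (mem_univ i), prod_eq_one]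
    · simp
    · intro k hk
      have hk' := (mem_erase.1 hk).1
      rw [if_neg (by simpa using hk'), hw k hk', Matrix.one_apply_eq]
  rw [Matrix.mul_apply, ← sum_subset (subset_univ {Function.update x i 0, Function.update x i 1}),
    sum_pair hne, hprod _ (fun k hk => by simp [hk]), hprod _ (fun k hk => by simp [hk])]
  · simp [hm, entries, hadBit, setBit]
    ring
  · intro w _ hw
    suffices had {i} x w = 0 by rw [this, zero_mul]
    by_cases h : ∀ k ≠ i, x k = w k
    · exfalso
      apply hw
      have : w = Function.update x i (w i) := by
        funext k
        by_cases hk : k = i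
        · subst hk; simp
        · simp [hk, h k hk]
      rw [this]
      rcases zmod_two_cases (w i) with h | h <;> simp [h]
    · push Not at h
      obtain ⟨k, hk, hne⟩ := h
      rw [had, tens, Matrix.of_apply]
      exact prod_eq_zero (mem_univ k) (by simp [hk, hne])

/-- Removal of a Hadamard gate. -/
theorem hadBit_mem {f : Bits₂ n → ℂ} (hf : f ∈ quadPhase n) {i : Fin n} {l : Bits₂ n → ZMod 2}
    (hl : IsAff l) (hi : IndepBit i l)
    (h : ∀ z, f z = f (setBit i 0 z) * (iota (z.1 i) * sgn (z.1 i * l z))) :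
    hadBit i f ∈ quadPhase n := by
  -- Summing over bit `i` leaves `(1 ± i)/√2`, which is `ω` times a phase depending only on `z.1 i +
  -- l z`.
  have hm := (IsAff.fst i).add hl
  have := quadPhase_mul (quadPhase_mul (quadPhase_comp hf (setBitZero i)) quadPhase_omega8)
    (quadPhase_mul (quadPhase_aff hm) (quadPhase_sgn hm))
  convert this using 2 with z
  change _ = f (setBit i 0 z) * omega8 * _
  rw [hadBit, h (setBit i 1 z), setBit_setBit, setBit_fst_self, hi, omega8]
  rcases zmod_two_cases (z.1 i) with h1 | h1 <;> rcases zmod_two_cases (l z) with h2 | h2 <;>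
    simp [h1, h2, zmod_two_add_self]
  · ring
  · linear_combination (((Real.sqrt 2 : ℝ) : ℂ)⁻¹ * f (setBit i 0 z)) * Complex.I_sq
  · linear_combination (((Real.sqrt 2 : ℝ) : ℂ)⁻¹ * f (setBit i 0 z)) * Complex.I_sq
  · ring

/-- A multiplication operator passes a Hadamard gate. -/
theorem mul_hadBit {f : Bits₂ n → ℂ} {i : Fin n} {l : Bits₂ n → ZMod 2} (hi : IndepBit i l)
    (h : ∀ z, f z = f (setBit i 0 z) * sgn (z.1 i * l z)) (g : Bits₂ n → ℂ) :
    (fun z => g z * hadBit i f z) = hadBit i fun z => g (setBit i (l z) z) * f z := by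
  funext z
  simp only [hadBit, hi 0 z, hi 1 z, setBit_setBit]
  rw [h (setBit i 1 z), setBit_setBit, setBit_fst_self, hi, one_mul]
  -- `hadBit i f` is supported where `z.1 i = l z`, so only the values of `g` there matter.
  by_cases hz : z.1 i = l z
  · rw [← hz, setBit_self]; ring
  · have : sgn (z.1 i) * sgn (l z) = -1 := by
      rcases zmod_two_cases (z.1 i) with h1 | h1 <;> rcases zmod_two_cases (l z) with h2 | h2 <;>
        simp [h1, h2] at hz ⊢
    linear_combination (g z - g (setBit i (l z) z)) * ((Real.sqrt 2 : ℝ) : ℂ)⁻¹ *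
      f (setBit i 0 z) * this

/-- Removal of two Hadamard gates. -/
theorem hadBit_hadBit_mem {f : Bits₂ n → ℂ} (hf : f ∈ quadPhase n) {i j : Fin n} (hij : i ≠ j)
    {u v : Bits₂ n → ZMod 2} (hu : IsAff u) (hv : IsAff v) (hui : IndepBit i u)
    (huj : IndepBit j u) (hvi : IndepBit i v) (hvj : IndepBit j v)
    (h : ∀ z, f z = f (setBit i 0 (setBit j 0 z)) *
      sgn (z.1 i * z.1 j + z.1 i * u z + z.1 j * v z)) :
    hadBit i (hadBit j f) ∈ quadPhase n := by
  -- Summing over one bit forces the other to equal `u` plus the new bit `i`; what remains is the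
  -- sign of a product of two affine functions.
  have := quadPhase_mul (quadPhase_comp hf (setBitZero i ∘ₗ setBitZero j))
    (quadPhase_sgn_mul ((IsAff.fst i).add hu) ((IsAff.fst j).add hv))
  convert this using 2 with z
  change _ = f (setBit i 0 (setBit j 0 z)) * _
  have key : ∀ b c, f (setBit j b (setBit i c z)) = f (setBit i 0 (setBit j 0 z)) *
      sgn (c * b + c * u z + b * v z) := by
    intro b c
    rw [h, setBit_fst_self, setBit_fst_of_ne hij, setBit_fst_self, huj, hui, hvj, hvi,
      setBit_setBit, setBit_comm hij, setBit_setBit, setBit_comm hij.symm]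
  simp only [hadBit, key, setBit_fst_of_ne hij.symm]
  have h2 := sqrt_two_inv_sq
  rcases zmod_two_cases (z.1 i) with h3 | h3 <;> rcases zmod_two_cases (z.1 j) with h4 | h4 <;>
  rcases zmod_two_cases (u z) with h5 | h5 <;> rcases zmod_two_cases (v z) with h6 | h6 <;>
    simp [h3, h4, h5, h6, zmod_two_add_self] <;>
    first
    | linear_combination (2 * f (setBit i 0 (setBit j 0 z))) * h2
    | linear_combination (-2 * f (setBit i 0 (setBit j 0 z))) * h2

end CliffordDepth

namespace CliffordDepth

open Finset

variable {n : ℕ}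

/-! ### The normal form of Clifford operations -/

/-- Up to Hadamard gates on the qubits in `S`, the entries of `V` form a quadratic phase. -/
def HasForm (S : Finset (Fin n)) (V : Op n) : Prop :=
  ∃ f ∈ quadPhase n, V = had S * entries f

theorem had_erase {S : Finset (Fin n)} {i : Fin n} (hi : i ∈ S) :
    had S = had (S.erase i) * had {i} := by
  rw [had_union (by simp), union_comm, ← insert_eq, insert_erase hi]

theorem had_comm (S T : Finset (Fin n)) : had S * had T = had T * had S := by
  rw [had, had, tens_mul_tens, tens_mul_tens]
  congr 1; funext k
  split_ifs <;> simp

theorem dg_mul_had {S : Finset (Fin n)} {g : Bits n → ℂ}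
    (hg : ∀ x y : Bits n, (∀ k ∉ S, x k = y k) → g x = g y) : dg g * had S = had S * dg g := by
  ext x y
  rw [dg, Matrix.diagonal_mul, Matrix.mul_diagonal]
  by_cases h : ∀ k ∉ S, x k = y k
  · rw [hg x y h, mul_comm]
  · push Not at h
    obtain ⟨k, hk, hne⟩ := h
    have : had S x y = 0 := by
      rw [had, tens, Matrix.of_apply]
      exact prod_eq_zero (mem_univ k) (by simp [hk, hne])
    rw [this, mul_zero, zero_mul]

theorem HasForm.had {S : Finset (Fin n)} {V : Op n} (h : HasForm S V) (i : Fin n) :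
    ∃ T, HasForm T (had {i} * V) := by
  obtain ⟨f, hf, rfl⟩ := h
  by_cases hi : i ∈ S
  · refine ⟨S.erase i, f, hf, ?_⟩
    rw [had_erase hi, had_comm, ← mul_assoc, ← mul_assoc, had_mul_had, one_mul]
  · refine ⟨{i} ∪ S, f, hf, ?_⟩
    rw [← mul_assoc, had_union (by simpa using hi)]

theorem exists_minimal_form {S : Finset (Fin n)} {V : Op n} (h : HasForm S V) :
    ∃ T, HasForm T V ∧ ∀ T', HasForm T' V → T.card ≤ T'.card := by
  obtain ⟨T, hT, hmin⟩ := (Set.toFinite {T | HasForm T V}).exists_minimalFor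
    Finset.card _ ⟨S, h⟩
  refine ⟨T, hT, fun T' hT' => ?_⟩
  rcases le_total T.card T'.card with h | h
  · exact h
  · exact hmin hT' h

/-- In a minimal form, no Hadamard gate can be removed. -/
theorem split_of_minimal {S : Finset (Fin n)} {f : Bits₂ n → ℂ} (hf : f ∈ quadPhase n)
    (hmin : ∀ T', HasForm T' (had S * entries f) → S.card ≤ T'.card) {i : Fin n} (hi : i ∈ S) :
    ∃ l, IsAff l ∧ IndepBit i l ∧ ∀ z, f z = f (setBit i 0 z) * sgn (z.1 i * l z) := by
  obtain ⟨l, hl, hli, h | h⟩ := quadPhase_split hf i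
  · exact ⟨l, hl, hli, h⟩
  · have := hmin (S.erase i) ⟨_, hadBit_mem hf hl hli h, by
      rw [had_erase hi, mul_assoc, had_mul_entries]⟩
    have := card_erase_lt_of_mem hi
    omega

/-- In a minimal form a Hadamard gate on `i` confines the result to `x i = l` with `l` affine. There
the Phase gate acts as `iota l`, which does not involve bit `i` and passes the Hadamard gate. -/
theorem HasForm.phase {S : Finset (Fin n)} {V : Op n} (h : HasForm S V) (i : Fin n) :
    ∃ T, HasForm T ((dg fun x => iota (x i)) * V) := by
  obtain ⟨T, ⟨f, hf, rfl⟩, hmin⟩ := exists_minimal_form h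
  refine ⟨T, ?_⟩
  by_cases hi : i ∈ T
  · obtain ⟨l, hl, hli, hs⟩ := split_of_minimal hf hmin hi
    refine ⟨_, quadPhase_mul (quadPhase_aff hl) hf, ?_⟩
    rw [had_erase hi, ← mul_assoc, ← mul_assoc, dg_mul_had, mul_assoc, mul_assoc, mul_assoc,
      had_mul_entries, had_mul_entries, dg_mul_entries, mul_hadBit hli hs fun z => iota (z.1 i)]
    · simp only [setBit_fst_self]
    · intro x y hxy
      rw [hxy i (by simp)]
  · refine ⟨_, quadPhase_mul (quadPhase_aff (IsAff.fst i)) hf, ?_⟩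
    rw [← mul_assoc, dg_mul_had, mul_assoc, dg_mul_entries]
    intro x y hxy
    rw [hxy i hi]

theorem HasForm.cz_of_notMem {S : Finset (Fin n)} {f : Bits₂ n → ℂ} (hf : f ∈ quadPhase n)
    (hmin : ∀ T', HasForm T' (CliffordDepth.had S * entries f) → S.card ≤ T'.card) {i j : Fin n}
    (hij : i ≠ j) (hi : i ∈ S) (hj : j ∉ S) :
    HasForm S ((dg fun x => sgn (x i * x j)) * (CliffordDepth.had S * entries f)) := by
  obtain ⟨l, hl, hli, hs⟩ := split_of_minimal hf hmin hi
  refine ⟨_, quadPhase_mul (quadPhase_sgn_mul hl (IsAff.fst j)) hf, ?_⟩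
  rw [had_erase hi, ← mul_assoc, ← mul_assoc, dg_mul_had, mul_assoc, mul_assoc, mul_assoc,
    had_mul_entries, had_mul_entries, dg_mul_entries,
    mul_hadBit hli hs fun z => sgn (z.1 i * z.1 j)]
  · simp only [setBit_fst_self, setBit_fst_of_ne hij.symm]
  · intro x y hxy
    rw [hxy i (by simp), hxy j (by simp [hj])]

theorem IndepBit.comp_setBit {i j : Fin n} {l : Bits₂ n → ZMod 2} (h : IndepBit i l)
    (b : ZMod 2) (hij : i ≠ j) : IndepBit i fun z => l (setBit j b z) := by
  intro c z
  simp only [setBit_comm hij.symm, h c]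

theorem indepBit_comp_setBit {j : Fin n} (l : Bits₂ n → ZMod 2)
    (b : ZMod 2) : IndepBit j fun z => l (setBit j b z) := by
  intro c z
  simp only [setBit_setBit]

/-- If the coefficient `l` of `x i` does not involve `x j`, both bits are confined to affine values
`l` and `m`, and CZ becomes the quadratic phase `sgn (l * m)`. Otherwise the exponent contains `x i
* x j`, and both Hadamard gates could be removed, against minimality. -/
theorem HasForm.cz_of_mem {S : Finset (Fin n)} {f : Bits₂ n → ℂ} (hf : f ∈ quadPhase n)
    (hmin : ∀ T', HasForm T' (CliffordDepth.had S * entries f) → S.card ≤ T'.card) {i j : Fin n}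
    (hij : i ≠ j) (hi : i ∈ S) (hj : j ∈ S) :
    HasForm S ((dg fun x => sgn (x i * x j)) * (CliffordDepth.had S * entries f)) := by
  obtain ⟨l, hl, hli, hs⟩ := split_of_minimal hf hmin hi
  obtain ⟨m, hm, hmj, ht⟩ := split_of_minimal hf hmin hj
  have hj' : j ∈ S.erase i := mem_erase.2 ⟨hij.symm, hj⟩
  have hS : CliffordDepth.had S = CliffordDepth.had ((S.erase i).erase j) *
      (CliffordDepth.had {i} * CliffordDepth.had {j}) := by
    rw [had_erase hi, had_erase hj', mul_assoc, had_comm {i}]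
  have hcoef : IndepBit j l ∨ ∀ z, l z = z.1 j + l (setBit j 0 z) := by
    obtain ⟨g, c, hg⟩ := hl
    have h1 : ∀ z, l z = l (setBit j 0 z) + z.1 j * g (Pi.single j 1, 0) := by
      intro z
      rw [hg, hg (setBit j 0 z)]
      conv_lhs => rw [setBit_eq_add j z]
      rw [map_add, map_smul, smul_eq_mul]
      ring
    rcases zmod_two_cases (g (Pi.single j 1, 0)) with h | h
    · left
      intro b z
      rw [h1, h1 z, h, setBit_setBit, mul_zero, mul_zero]
    · right
      intro z
      rw [h1, h]
      ring
  rcases hcoef with hlj | hcoef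
  · refine ⟨_, quadPhase_mul (quadPhase_sgn_mul hl hm) hf, ?_⟩
    have e1 : ∀ z, hadBit j f z = hadBit j f (setBit i 0 z) * sgn (z.1 i * l z) := by
      intro z
      simp only [hadBit, setBit_fst_of_ne hij.symm]
      rw [hs (setBit j 0 z), hs (setBit j 1 z), setBit_fst_of_ne hij, setBit_fst_of_ne hij, hlj, hlj,
        setBit_comm hij, setBit_comm hij]
      ring
    rw [hS, mul_assoc, mul_assoc, had_mul_entries, had_mul_entries, ← mul_assoc, dg_mul_had,
      mul_assoc, dg_mul_entries, mul_assoc, mul_assoc, had_mul_entries, had_mul_entries,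
      mul_hadBit hli e1 fun z => sgn (z.1 i * z.1 j)]
    · simp only [setBit_fst_self, setBit_fst_of_ne hij.symm]
      rw [mul_hadBit hmj ht fun z => sgn (l z * z.1 j)]
      simp only [setBit_fst_self, hlj _ _]
    · intro x y hxy
      rw [hxy i (by simp), hxy j (by simp)]
  · exfalso
    have := hmin ((S.erase i).erase j) ⟨_, hadBit_hadBit_mem hf hij (u := fun z => l (setBit j 0 z))
      (v := fun z => m (setBit i 0 z)) (hl.comp (setBitZero j)) (hm.comp (setBitZero i))
      (hli.comp_setBit 0 hij) (indepBit_comp_setBit l 0) (indepBit_comp_setBit m 0)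
      (hmj.comp_setBit 0 hij.symm) (fun z => by
        rw [hs z, ht (setBit i 0 z), setBit_fst_of_ne hij.symm, setBit_comm hij.symm, hcoef z,
          mul_assoc, ← sgn_add]
        congr 2
        ring), by
      rw [hS, mul_assoc, mul_assoc, had_mul_entries, had_mul_entries]⟩
    have h1 := card_erase_lt_of_mem hi
    have h2 := card_erase_lt_of_mem hj'
    omega

theorem HasForm.cz {S : Finset (Fin n)} {V : Op n} (h : HasForm S V) {i j : Fin n} (hij : i ≠ j) :
    ∃ T, HasForm T ((dg fun x => sgn (x i * x j)) * V) := by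
  obtain ⟨T, ⟨f, hf, rfl⟩, hmin⟩ := exists_minimal_form h
  refine ⟨T, ?_⟩
  by_cases hi : i ∈ T <;> by_cases hj : j ∈ T
  · exact HasForm.cz_of_mem hf hmin hij hi hj
  · exact HasForm.cz_of_notMem hf hmin hij hi hj
  · rw [show (dg fun x : Bits n => sgn (x i * x j)) = dg fun x => sgn (x j * x i) by
      simp only [mul_comm]]
    exact HasForm.cz_of_notMem hf hmin hij.symm hj hi
  · refine ⟨_, quadPhase_mul (quadPhase_sgn_mul (IsAff.fst i) (IsAff.fst j)) hf, ?_⟩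
    rw [← mul_assoc, dg_mul_had, mul_assoc, dg_mul_entries]
    intro x y hxy
    rw [hxy i hi, hxy j hj]

theorem addBit_eq_had {i j : Fin n} (hij : i ≠ j) :
    fn (addBit i j) = had {j} * (dg fun x => sgn (x i * x j)) * had {j} := by
  have := had_dg_had {j} (fun (x : Bits n) _ => x i) (fun x w h => by
    funext _
    exact h i (by simpa using hij))
  simp only [sum_singleton] at this
  rw [show (dg fun x : Bits n => sgn (x i * x j)) = dg fun x => sgn (x j * x i) by
    simp only [mul_comm], this]
  congr 1; funext x k
  by_cases hk : k = j
  · subst hk; simp [addBit]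
  · simp [addBit, hk]

theorem HasForm.gate {S : Finset (Fin n)} {V : Op n} (h : HasForm S V) (g : Gate n) :
    ∃ T, HasForm T (gmat g * V) := by
  cases g with
  | H i => rw [gmat_H]; exact h.had i
  | P i => rw [gmat_P]; exact h.phase i
  | CZ i j hij => rw [gmat_CZ]; exact h.cz hij
  | CNOT i j hij =>
    rw [gmat_CNOT, addBit_eq_had hij, mul_assoc, mul_assoc]
    obtain ⟨T, hT⟩ := h.had j
    obtain ⟨T, hT⟩ := hT.cz hij
    exact hT.had j

theorem had_univ_apply (x y : Bits n) :
    had univ x y = ((Real.sqrt 2 : ℝ) : ℂ)⁻¹ ^ n * sgn (∑ k, x k * y k) := by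
  simp [had, tens, hm, prod_mul_distrib, sgn_sum]

theorem sqrt_two_pow_smul_had :
    ((Real.sqrt 2 : ℝ) : ℂ) ^ n • had univ = entries fun z : Bits₂ n => sgn (∑ k, z.1 k * z.2 k) := by
  ext x y
  rw [Matrix.smul_apply, had_univ_apply, smul_eq_mul, ← mul_assoc, ← mul_pow,
    mul_inv_cancel₀ sqrt_two_ne, one_pow, one_mul]
  rfl

/-- Clifford operations have a normal form. -/
theorem exists_hasForm (c : Circuit n) :
    ∃ S, HasForm S (((Real.sqrt 2 : ℝ) : ℂ) ^ n • (cmat c * had univ)) := by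
  -- The last gate acts from the left, hence the induction from the end. For the empty circuit the
  -- factor `had univ`, rescaled by `√2 ^ n`, has the entries `(-1) ^ (x · y)`, a quadratic phase
  -- without zeros.
  induction c using List.reverseRecOn with
  | nil =>
    refine ⟨∅, fun z => sgn (∑ k, z.1 k * z.2 k), ?_, ?_⟩
    rotate_left
    · rw [had_empty, one_mul, cmat_nil, one_mul, sqrt_two_pow_smul_had]
    · simp only [sgn_sum]
      have := (quadPhase n).prod_mem (t := univ)
        (f := fun (k : Fin n) (z : Bits₂ n) => sgn (z.1 k * z.2 k))
        (fun k _ => quadPhase_sgn_mul (IsAff.fst k) (IsAff.snd k))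
      convert this using 1
      ext z
      rw [Finset.prod_apply]
  | append_singleton c g ih =>
    obtain ⟨S, h⟩ := ih
    rw [cmat_append, cmat_singleton, mul_assoc, ← Matrix.mul_smul]
    exact h.gate g

end CliffordDepth

namespace CliffordDepth

open Finset Matrix

variable {n : ℕ}

/-! ### Phases of a single index -/

/-- Phases of CZ and Phase gates. -/
def IsPhase (A : Bits n → ℂ) : Prop :=
  ∃ (a : Fin n → ℕ) (Γ : Fin n → Fin n → ZMod 2), ∀ x, A x = (∏ i, iota (x i) ^ a i) *
    sgn (∑ p : Fin n × Fin n with p.1 < p.2, Γ p.1 p.2 * (x p.1 * x p.2))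

theorem IsPhase.one : IsPhase fun _ : Bits n => 1 := ⟨0, 0, by simp⟩

theorem IsPhase.mul {A B : Bits n → ℂ} (hA : IsPhase A) (hB : IsPhase B) :
    IsPhase fun x => A x * B x := by
  obtain ⟨a, Γ, hA⟩ := hA
  obtain ⟨b, Δ, hB⟩ := hB
  refine ⟨a + b, Γ + Δ, fun x => ?_⟩
  simp only [hA, hB, Pi.add_apply, pow_add, prod_mul_distrib, add_mul, sum_add_distrib, sgn_add]
  ring

theorem IsPhase.prod {ι : Type*} (T : Finset ι) {A : ι → Bits n → ℂ}
    (hA : ∀ k ∈ T, IsPhase (A k)) : IsPhase fun x => ∏ k ∈ T, A k x := by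
  classical
  induction T using Finset.induction_on with
  | empty => simpa using IsPhase.one
  | insert k T hk ih =>
    simp only [prod_insert hk]
    exact (hA k (mem_insert_self _ _)).mul (ih fun l hl => hA l (mem_insert_of_mem hl))

theorem IsPhase.iota (i : Fin n) : IsPhase fun x => iota (x i) := by
  refine ⟨Pi.single i 1, 0, fun x => ?_⟩
  rw [prod_eq_single i (fun k _ hk => by simp [hk]) (by simp)]
  simp

theorem IsPhase.cz {i j : Fin n} (hij : i < j) : IsPhase fun x => sgn (x i * x j) := by
  refine ⟨0, fun k l => if k = i ∧ l = j then 1 else 0, fun x => ?_⟩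
  rw [sum_eq_single (i, j)]
  · simp
  · rintro ⟨k, l⟩ _ hp
    have : ¬ (k = i ∧ l = j) := fun h => hp (Prod.ext h.1 h.2)
    simp [this]
  · simp [hij]

/-- For `i = j` the sign is that of `x i`, which is the square of a Phase gate. -/
theorem IsPhase.sgn_mul (i j : Fin n) (c : ZMod 2) : IsPhase fun x => sgn (c * (x i * x j)) := by
  rcases zmod_two_cases c with rfl | rfl
  · simpa using IsPhase.one
  · simp only [one_mul]
    rcases lt_trichotomy i j with h | rfl | h
    · exact IsPhase.cz h
    · simpa only [zmod_two_mul_self, iota_sq] using (IsPhase.iota i).mul (IsPhase.iota i)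
    · simpa only [mul_comm] using IsPhase.cz h

theorem IsPhase.iota_sum (α : Fin n → ZMod 2) (T : Finset (Fin n)) :
    IsPhase fun x => CliffordDepth.iota (∑ k ∈ T, α k * x k) := by
  induction T using Finset.induction_on with
  | empty => simpa using IsPhase.one
  | insert k T hk ih =>
    have h1 : IsPhase fun x => CliffordDepth.iota (α k * x k) := by
      rcases zmod_two_cases (α k) with h | h
      · simpa [h] using IsPhase.one
      · simpa [h] using IsPhase.iota k
    have h2 : IsPhase fun x => sgn (α k * x k * ∑ l ∈ T, α l * x l) := by
      simp only [mul_sum, sgn_sum]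
      refine IsPhase.prod T fun l _ => ?_
      have := IsPhase.sgn_mul k l (α k * α l)
      convert this using 3
      ring
    simp only [sum_insert hk, iota_add]
    exact (h1.mul ih).mul h2

theorem IsPhase.ne_zero {A : Bits n → ℂ} (hA : IsPhase A) (x : Bits n) : A x ≠ 0 := by
  obtain ⟨a, Γ, hA⟩ := hA
  have h1 : ∀ b : ZMod 2, CliffordDepth.iota b ≠ 0 := by
    intro b
    rcases zmod_two_cases b with rfl | rfl <;> simp
  have h2 : ∀ b : ZMod 2, sgn b ≠ 0 := by
    intro b
    rcases zmod_two_cases b with rfl | rfl <;> simp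
  rw [hA]
  exact mul_ne_zero (prod_ne_zero_iff.2 fun i _ => pow_ne_zero _ (h1 _)) (h2 _)

theorem Impl.pow_free {U : Op n} (h : Impl ∅ 0 U) (k : ℕ) : Impl ∅ 0 (U ^ k) := by
  induction k with
  | zero => rw [pow_zero]; exact Impl.one
  | succ k ih => rw [pow_succ]; exact ih.mul h

theorem dg_pow (f : Bits n → ℂ) (k : ℕ) : dg f ^ k = dg fun x => f x ^ k :=
  Matrix.diagonal_pow f k

theorem Impl.phase {A : Bits n → ℂ} (hA : IsPhase A) :
    Impl univ ((n - 1) / 2 + 1 + (2 * Nat.clog 2 n + 1)) (dg A) := by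
  obtain ⟨a, Γ, hA⟩ := hA
  let E : Finset (Fin n × Fin n) := univ.filter fun p => p.1 < p.2 ∧ Γ p.1 p.2 = 1
  have e : dg A = (dg fun x => ∏ i, CliffordDepth.iota (x i) ^ a i) * czPhase E := by
    rw [czPhase, dg_mul_dg]
    congr 1; funext x
    rw [hA, sum_edges_eq (univ.filter fun p => p.1 < p.2) E
      (fun p hp => mem_filter.2 ⟨mem_univ _, (mem_filter.1 hp).2.1⟩) (fun p => Γ p.1 p.2)]
    intro p hp
    have hp' := (mem_filter.1 hp).2
    rcases zmod_two_cases (Γ p.1 p.2) with h | h <;> simp [E, h, hp']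
  have hfree : ∀ T : Finset (Fin n),
      Impl ∅ 0 (dg fun x => ∏ i ∈ T, CliffordDepth.iota (x i) ^ a i) := by
    intro T
    induction T using Finset.induction_on with
    | empty => simpa [dg_one] using Impl.one
    | insert k T hk ih =>
      simp only [prod_insert hk]
      rw [← dg_mul_dg, ← dg_pow]
      exact ((Impl.P k).pow_free _).mul ih
  rw [e]
  exact Impl.free_mul (hfree univ) (Impl.czPhase_univ E fun p hp => (mem_filter.1 hp).2.1)

/-- The structure of a quadratic phase. -/
theorem exists_factorization {f : Bits₂ n → ℂ} (hf : f ∈ quadPhase n) :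
    ∃ (k : ℕ) (A A' : Bits n → ℂ) (B : Matrix (Fin n) (Fin n) (ZMod 2)), IsPhase A ∧ IsPhase A' ∧
      ∀ x y, f (x, y) = omega8 ^ k * A x * sgn (∑ i, x i * (B *ᵥ y) i) * A' y := by
  induction hf using Submonoid.closure_induction with
  | mem f hf =>
    rcases hf with rfl | ⟨g, rfl⟩
    · exact ⟨1, _, _, 0, IsPhase.one, IsPhase.one, by simp⟩
    · let α : Fin n → ZMod 2 := fun k => g (fun j => if k = j then 1 else 0, 0)
      let β : Fin n → ZMod 2 := fun k => g (0, fun j => if k = j then 1 else 0)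
      have h1 : ∀ x y, g (x, y) = ∑ k, α k * x k + ∑ k, β k * y k := by
        intro x y
        have e : (x, y) = LinearMap.inl (ZMod 2) (Bits n) (Bits n) x +
          LinearMap.inr (ZMod 2) (Bits n) (Bits n) y := by simp
        have e1 := LinearMap.pi_apply_eq_sum_univ (g ∘ₗ LinearMap.inl (ZMod 2) (Bits n) (Bits n)) x
        have e2 := LinearMap.pi_apply_eq_sum_univ (g ∘ₗ LinearMap.inr (ZMod 2) (Bits n) (Bits n)) y
        rw [e, map_add]
        simp only [LinearMap.comp_apply, smul_eq_mul] at e1 e2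
        rw [e1, e2]
        congr 1 <;> exact sum_congr rfl fun k _ => mul_comm _ _
      -- Splitting `iota` of a sum leaves the cross sign `sgn ((α · x) (β · y))`, a bilinear form of
      -- rank at most one.
      refine ⟨0, _, _, Matrix.of fun i j => α i * β j, IsPhase.iota_sum α univ,
        IsPhase.iota_sum β univ, fun x y => ?_⟩
      have h2 : ∑ i, x i * ((Matrix.of fun i j => α i * β j) *ᵥ y) i =
          (∑ k, α k * x k) * ∑ k, β k * y k := by
        rw [sum_mul]
        refine sum_congr rfl fun i _ => ?_
        rw [Matrix.mulVec, dotProduct, mul_sum, mul_sum]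
        refine sum_congr rfl fun j _ => ?_
        rw [Matrix.of_apply]
        ring
      change CliffordDepth.iota (g (x, y)) = _
      rw [h1, h2, iota_add]
      ring
  | one => exact ⟨0, _, _, 0, IsPhase.one, IsPhase.one, by simp⟩
  | mul f g _ _ hf hg =>
    obtain ⟨k, A, A', B, hA, hA', hf⟩ := hf
    obtain ⟨l, C, C', D, hC, hC', hg⟩ := hg
    refine ⟨k + l, _, _, B + D, hA.mul hC, hA'.mul hC', fun x y => ?_⟩
    rw [Pi.mul_apply, hf, hg]
    simp only [add_mulVec, Pi.add_apply, mul_add, sum_add_distrib, sgn_add, pow_add]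
    ring

/-! ### The global phase -/

/-- The identity `(H P)^3 = ω`; it realizes the global phase exactly with single-qubit gates alone.
-/
theorem omega8_smul (i : Fin n) :
    (omega8 • 1 : Op n) = (had {i} * dg fun x => iota (x i)) ^ 3 := by
  have key : ∀ f : Bits₂ n → ℂ, (had {i} * dg fun x => iota (x i)) ^ 3 * entries f =
      omega8 • entries f := by
    intro f
    rw [pow_succ, pow_two]
    simp only [mul_assoc, dg_mul_entries, had_mul_entries]
    ext x y
    rw [Matrix.smul_apply, entries, entries, Matrix.of_apply, Matrix.of_apply, smul_eq_mul]
    generalize (x, y) = z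
    have h2 := sqrt_two_inv_sq
    have hI := Complex.I_sq
    rw [omega8]
    conv_rhs => rw [← setBit_self i z]
    simp only [hadBit, setBit_setBit, setBit_fst_self, iota_zero, iota_one, sgn_zero, sgn_one]
    rcases zmod_two_cases (z.1 i) with h | h
    · rw [h, sgn_zero]
      linear_combination ((Real.sqrt 2 : ℝ) : ℂ)⁻¹ ^ 3 * (-f (setBit i 0 z) +
        f (setBit i 1 z) * Complex.I) * hI + 2 * ((Real.sqrt 2 : ℝ) : ℂ)⁻¹ * (1 + Complex.I) *
        f (setBit i 0 z) * h2
    · rw [h, sgn_one]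
      linear_combination ((Real.sqrt 2 : ℝ) : ℂ)⁻¹ ^ 3 * (f (setBit i 0 z) +
        f (setBit i 1 z) * (-2 - Complex.I)) * hI + 2 * ((Real.sqrt 2 : ℝ) : ℂ)⁻¹ *
        (1 + Complex.I) * f (setBit i 1 z) * h2
  have h1 : (1 : Op n) = entries fun z => (1 : Op n) z.1 z.2 := rfl
  have := key fun z => (1 : Op n) z.1 z.2
  rw [← h1, mul_one] at this
  exact this.symm

theorem Impl.omega8_pow (hn : 0 < n) (k : ℕ) : Impl ∅ 0 (omega8 ^ k • 1 : Op n) := by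
  have h : Impl ∅ 0 (omega8 • 1 : Op n) := by
    rw [omega8_smul ⟨0, hn⟩]
    exact ((Impl.H _).mul (Impl.P _)).pow_free 3
  have e : (omega8 ^ k • 1 : Op n) = (omega8 • 1) ^ k := by rw [smul_pow, one_pow]
  rw [e]
  exact h.pow_free k

/-! ### Triangular decomposition -/

/-- Lower unitriangular matrices. -/
def IsLowerUni (L : Matrix (Fin n) (Fin n) (ZMod 2)) : Prop :=
  (∀ i, L i i = 1) ∧ ∀ i j, i < j → L i j = 0

/-- Gaussian elimination downwards with column pivoting. Over two elements every pivot is `1`, so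
both triangular factors are unitriangular; the upper one is written as a transpose, so that `L` and
`T` are of the same kind. -/
theorem exists_lup (A : Matrix (Fin n) (Fin n) (ZMod 2)) (hA : A.det ≠ 0) :
    ∃ (L T : Matrix (Fin n) (Fin n) (ZMod 2)) (σ : Equiv.Perm (Fin n)),
      IsLowerUni L ∧ IsLowerUni T ∧ (L * A).submatrix id σ = Tᵀ := by
  suffices h : ∀ k ≤ n, ∃ (L : Matrix (Fin n) (Fin n) (ZMod 2)) (σ : Equiv.Perm (Fin n)),
      IsLowerUni L ∧ ∀ j : Fin n, (j : ℕ) < k → (L * A) j (σ j) = 1 ∧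
        ∀ i, j < i → (L * A) i (σ j) = 0 by
    obtain ⟨L, σ, hL, h⟩ := h n le_rfl
    exact ⟨L, ((L * A).submatrix id σ)ᵀ, σ, hL,
      ⟨fun i => (h i i.2).1, fun i j hij => (h i i.2).2 j hij⟩, (transpose_transpose _).symm⟩
  intro k
  induction k with
  | zero =>
    intro _
    refine ⟨1, 1, ⟨fun i => one_apply_eq i, fun i j hij => one_apply_ne hij.ne⟩, fun j hj => ?_⟩
    exact absurd hj (Nat.not_lt_zero _)
  | succ k ih =>
    intro hk
    obtain ⟨L, σ, hL, h⟩ := ih (by omega)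
    let r : Fin n := ⟨k, by omega⟩
    have hdet : (L * A).det ≠ 0 := by
      rw [det_mul, det_of_unitriangular hL.1 hL.2, one_mul]
      exact hA
    -- Row `r` of an invertible matrix is nonzero. By `hjk` below, its pivot avoids the columns
    -- already cleared.
    obtain ⟨j, hj⟩ : ∃ j, (L * A) r (σ j) = 1 := by
      by_contra hcon
      push Not at hcon
      refine hdet (det_eq_zero_of_row_eq_zero r fun c => ?_)
      have := hcon (σ.symm c)
      rw [Equiv.apply_symm_apply] at this
      exact (zmod_two_cases _).resolve_right this
    have hjk : r ≤ j := by
      by_contra hlt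
      rw [not_le] at hlt
      have := (h j hlt).2 r hlt
      rw [hj] at this
      exact one_ne_zero this
    let σ' : Equiv.Perm (Fin n) := σ * Equiv.swap r j
    have hσr : σ' r = σ j := by simp [σ']
    have hσc : ∀ c : Fin n, c < r → σ' c = σ c := by
      intro c hc
      have : Equiv.swap r j c = c :=
        Equiv.swap_apply_of_ne_of_ne hc.ne (hc.trans_le hjk).ne
      simp [σ', this]
    -- Multiplication by `1 + N` adds row `r` to the lower rows with a one in the pivot column.
    let N : Matrix (Fin n) (Fin n) (ZMod 2) :=
      Matrix.of fun i c => if c = r ∧ r < i then (L * A) i (σ j) else 0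
    have hN : ∀ (M : Matrix (Fin n) (Fin n) (ZMod 2)) i c, ((1 + N) * M) i c =
        M i c + if r < i then (L * A) i (σ j) * M r c else 0 := by
      intro M i c
      rw [add_mul, one_mul, Matrix.add_apply, mul_apply]
      congr 1
      rw [sum_eq_single r]
      · by_cases hi : r < i <;> simp [N, hi]
      · intro b _ hb
        simp [N, hb]
      · simp
    refine ⟨(1 + N) * L, σ', ⟨fun i => ?_, fun i c hic => ?_⟩, fun c hc => ?_⟩
    · rw [hN, hL.1]
      split_ifs with hi
      · rw [hL.2 r i hi, mul_zero, add_zero]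
      · rw [add_zero]
    · rw [hN, hL.2 i c hic, zero_add]
      split_ifs with hi
      · rw [hL.2 r c (hi.trans hic), mul_zero]
      · rfl
    · rw [mul_assoc]
      rcases Nat.lt_succ_iff_lt_or_eq.1 hc with hck | hck
      · have hcr : c < r := hck
        rw [hσc c hcr]
        obtain ⟨h1, h2⟩ := h c hck
        refine ⟨?_, fun i hi => ?_⟩
        · rw [hN, h1, if_neg (not_lt.2 hcr.le), add_zero]
        · rw [hN, h2 i hi, h2 r hcr, mul_zero, ite_self, add_zero]
      · have hcr : c = r := Fin.ext hck
        subst hcr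
        rw [hσr]
        refine ⟨?_, fun i hi => ?_⟩
        · rw [hN, hj, if_neg (lt_irrefl _), add_zero]
        · rw [hN, if_pos hi, hj, mul_one, zmod_two_add_self]

/-- The kernel `(-1) ^ (x · B y)` is a product of Hadamard gates, a permutation and two
triangular matrices. -/
theorem exists_kernel_factorization (B : Matrix (Fin n) (Fin n) (ZMod 2)) (hB : B.det ≠ 0) :
    ∃ (L T : Matrix (Fin n) (Fin n) (ZMod 2)) (π : Equiv.Perm (Fin n)),
      IsLowerUni L ∧ IsLowerUni T ∧
      (entries fun z : Bits₂ n => sgn (∑ i, z.1 i * (B *ᵥ z.2) i)) =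
        ((Real.sqrt 2 : ℝ) : ℂ) ^ n • ((fn fun x k => x (π k)) * lin T * had univ * lin L) := by
  have hBu : IsUnit B.det := isUnit_iff_ne_zero.2 hB
  obtain ⟨L, T, σ, hL, hT, h⟩ := exists_lup B⁻¹ (by
    rw [det_nonsing_inv]
    exact (hBu.ringInverse).ne_zero)
  refine ⟨L, T, σ.symm, hL, hT, ?_⟩
  -- `M` is the permutation times `T`, and `Mᵀ * B = L`. So for `x = M w` the form `x · B y` equals
  -- `w · L y`, and only the standard kernel `(-1) ^ (w · y')` remains between `lin M` and `lin L`.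
  let M : Matrix (Fin n) (Fin n) (ZMod 2) := T.submatrix σ.symm id
  have hM : Mᵀ = L * B⁻¹ := by
    ext i j
    have := congrFun (congrFun h i) (σ.symm j)
    simpa [M] using this.symm
  have hMB : Mᵀ * B = L := by
    rw [hM, mul_assoc, nonsing_inv_mul _ hBu, mul_one]
  have hMdet : IsUnit M.det := by
    rw [← det_transpose, hM, det_mul, det_of_unitriangular hL.1 hL.2, one_mul, det_nonsing_inv]
    exact hBu.ringInverse
  have e1 : (fn fun (x : Bits n) k => x (σ.symm k)) * lin T = lin M := by
    rw [lin, lin, fn_mul_fn]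
    rfl
  rw [e1, mul_assoc, ← Matrix.mul_smul, ← Matrix.smul_mul, sqrt_two_pow_smul_had]
  ext x y
  have hinv : M *ᵥ (M⁻¹ *ᵥ x) = x := by
    rw [mulVec_mulVec, mul_nonsing_inv _ hMdet, one_mulVec]
  have huniq : ∀ w, x = M *ᵥ w → w = M⁻¹ *ᵥ x := by
    rintro w rfl
    rw [mulVec_mulVec, nonsing_inv_mul _ hMdet, one_mulVec]
  rw [mul_apply, sum_eq_single (M⁻¹ *ᵥ x)]
  · generalize M⁻¹ *ᵥ x = w at hinv
    subst hinv
    have e2 : ((entries fun z : Bits₂ n => sgn (∑ k, z.1 k * z.2 k)) * lin L) w y =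
        sgn (∑ k, w k * (L *ᵥ y) k) := by
      simp [mul_apply, lin, fn, entries]
    rw [e2, lin, fn, of_apply, if_pos rfl, one_mul, entries, of_apply]
    change sgn ((M *ᵥ w) ⬝ᵥ (B *ᵥ y)) = sgn (w ⬝ᵥ (L *ᵥ y))
    rw [← hMB, ← mulVec_mulVec, dotProduct_mulVec w, vecMul_transpose]
  · intro w _ hw
    rw [lin, fn, of_apply, if_neg (fun h => hw (huniq w h)), zero_mul]
  · simp

theorem IsLowerUni.impl {d : ℕ} (h : TriangularBound n d) {L : Matrix (Fin n) (Fin n) (ZMod 2)}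
    (hL : IsLowerUni L) : Impl univ d (lin L) :=
  h n univ L (by simp) hL.1 hL.2 (by simp)

/-! ### Clifford operations -/

theorem isUnit_had (S : Finset (Fin n)) : IsUnit (had S) :=
  IsUnit.of_mul_eq_one _ (had_mul_had S)

theorem isUnit_gmat (g : Gate n) : IsUnit (gmat g) := by
  cases g with
  | H i => rw [gmat_H]; exact isUnit_had _
  | P i =>
    rw [gmat_P]
    refine IsUnit.of_mul_eq_one (dg fun x => iota (x i) * sgn (x i)) ?_
    rw [dg_mul_dg, ← dg_one]
    congr 1; funext x
    rw [← mul_assoc, iota_sq, sgn_mul_self]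
  | CZ i j hij =>
    rw [gmat_CZ]
    refine IsUnit.of_mul_eq_one (dg fun x => sgn (x i * x j)) ?_
    rw [dg_mul_dg, ← dg_one]
    congr 1; funext x
    rw [sgn_mul_self]
  | CNOT i j hij =>
    rw [gmat_CNOT]
    refine IsUnit.of_mul_eq_one (fn (addBit i j)) ?_
    rw [fn_mul_fn, ← fn_id]
    simp only [addBit_addBit hij]

theorem isUnit_cmat (c : Circuit n) : IsUnit (cmat c) := by
  induction c with
  | nil => rw [cmat_nil]; exact isUnit_one
  | cons g c ih => rw [cmat_cons]; exact ih.mul (isUnit_gmat g)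

/-- The depth of a Clifford operation, in terms of the depth of triangular matrices. -/
theorem impl_clifford (hn : 0 < n) {d : ℕ} (hd : TriangularBound n d) (c : Circuit n) :
    Impl univ (2 * ((n - 1) / 2 + 1 + (2 * Nat.clog 2 n + 1)) + (6 + 2 * d)) (cmat c) := by
  obtain ⟨S, f, hf, hc⟩ := exists_hasForm c
  obtain ⟨k, A, A', B, hA, hA', hfac⟩ := exists_factorization hf
  have hs : ((Real.sqrt 2 : ℝ) : ℂ) ^ n ≠ 0 := pow_ne_zero _ sqrt_two_ne
  have hunit : IsUnit (entries f) := by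
    have e : entries f = had S * (((Real.sqrt 2 : ℝ) : ℂ) ^ n • (cmat c * had univ)) := by
      rw [hc, ← mul_assoc, had_mul_had, one_mul]
    rw [e]
    refine (isUnit_had S).mul ?_
    have := ((isUnit_cmat c).mul (isUnit_had univ)).smul (Units.mk0 _ hs)
    exact this
  -- If `B v = 0` with `v ≠ 0`, the columns of `entries f` at `v` and at `0` are proportional,
  -- contradicting invertibility.
  have hB : B.det ≠ 0 := by
    intro h0
    obtain ⟨v, hv, hBv⟩ := exists_mulVec_eq_zero_iff.2 h0
    let u : Bits n → ℂ := fun w => (if w = v then A' 0 else 0) - if w = 0 then A' v else 0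
    have h1 : entries f *ᵥ u = 0 := by
      funext x
      have e : (entries f *ᵥ u) x = f (x, v) * A' 0 - f (x, 0) * A' v := by
        simp [mulVec, dotProduct, u, mul_sub, entries]
      rw [e, hfac, hfac, hBv, mulVec_zero, Pi.zero_apply]
      ring
    have h2 : u = 0 := mulVec_injective_of_isUnit hunit (by rw [h1, mulVec_zero])
    have h3 := congrFun h2 v
    simp only [u, if_true, if_neg hv, sub_zero, Pi.zero_apply] at h3
    exact hA'.ne_zero 0 h3
  obtain ⟨L, T, π, hL, hT, hK⟩ := exists_kernel_factorization B hB
  have e : cmat c = had S * ((omega8 ^ k • 1) * (dg A * ((fn fun x k => x (π k)) * lin T *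
      had univ * lin L) * dg A')) * had univ := by
    have e1 : entries f = (((Real.sqrt 2 : ℝ) : ℂ) ^ n) • ((omega8 ^ k • 1) * (dg A *
        ((fn fun x k => x (π k)) * lin T * had univ * lin L) * dg A')) := by
      rw [← Matrix.mul_smul, ← Matrix.smul_mul, ← Matrix.mul_smul (dg A), ← hK]
      ext x y
      rw [Matrix.smul_mul, Matrix.smul_apply, one_mul, dg, dg, mul_diagonal, diagonal_mul]
      simp only [entries, of_apply, hfac, smul_eq_mul]
      ring
    rw [e1, Matrix.mul_smul] at hc
    have hc' := smul_right_injective _ hs hc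
    rw [← hc', mul_assoc, had_mul_had, mul_one]
  have hlin := (((Impl.perm π).mul (hT.impl hd)).mul_free (Impl.had univ)).mul (hL.impl hd)
  have := (Impl.free_mul (Impl.had S) (Impl.free_mul (Impl.omega8_pow hn k)
    (((Impl.phase hA).mul hlin).mul (Impl.phase hA')))).mul_free (Impl.had univ)
  rw [e]
  exact this.mono subset_rfl (by omega)

end CliffordDepth

namespace CliffordDepth

/-! ### Numerical estimates -/

theorem div_le_logb_two {n p m : ℕ} (hm : 0 < m) (h : 2 ^ p ≤ n ^ m) :
    (p / m : ℝ) ≤ Real.logb 2 n := by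
  have hn : 0 < n := by
    rcases Nat.eq_zero_or_pos n with rfl | hn
    · rw [zero_pow hm.ne'] at h
      exact absurd h (Nat.not_le.2 (by positivity))
    · exact hn
  have h' : ((2 : ℝ) ^ p) ≤ (n : ℝ) ^ m := by exact_mod_cast h
  have h2 := Real.logb_le_logb_of_le (b := 2) (by norm_num) (by positivity) h'
  rw [Real.logb_pow, Real.logb_pow, Real.logb_self_eq_one (by norm_num), mul_one] at h2
  rw [div_le_iff₀ (by exact_mod_cast hm)]
  linarith

/-- The bound increases with `log₂ n`, so a rational lower bound `q` reduces the estimate to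
arithmetic; `e` is the excess over `2n`. -/
theorem le_floor_of_le {n D : ℕ} {e : ℤ} {q : ℝ} (hD : (D : ℤ) ≤ 2 * n + e) (hq : 0 ≤ q)
    (hL : q ≤ Real.logb 2 n) (he : (e : ℝ) ≤ 2.9487 * q ^ 2 + 8.4909 * q - 44.4798) :
    (D : ℤ) ≤ ⌊2 * (n : ℝ) + 2.9487 * (Real.logb 2 n) ^ 2 + 8.4909 * Real.logb 2 n - 44.4798⌋ := by
  rw [Int.le_floor]
  have h1 : (D : ℝ) ≤ 2 * n + e := by exact_mod_cast hD
  have h2 : q ^ 2 ≤ Real.logb 2 n ^ 2 := pow_le_pow_left₀ hq hL 2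
  push_cast
  linarith

theorem TriangularBound.half {m d s l : ℕ} (h : TriangularBound m d) (hs : s ≤ 2 * m)
    (hl : m ≤ 2 ^ l) : TriangularBound s (d + (m / 2 + 1 + (2 * l + 1))) :=
  (h.step (bipartiteBound_half m) hs).mono le_rfl (by
    have := Nat.clog_le_of_le_pow hl
    omega)

theorem triangularBound_five : TriangularBound 5 6 :=
  ((triangularBound_one.double (s := 2) (by norm_num)).double (s := 3) (by norm_num)).double
    (by norm_num)

/-- Sizes `1, 2, 3, 6, 11, 22, 43` with costs `1 + 2 + 3 + 6 + 11 + 22 = 45`. -/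
theorem triangularBound_fortyThree : TriangularBound 43 45 :=
  (((((triangularBound_one.double (s := 2) (by norm_num)).double (s := 3) (by norm_num)).double
    (s := 6) (by norm_num)).double (s := 11) (by norm_num)).double (s := 22) (by norm_num)).double
    (by norm_num)

theorem triangularBound_seventyTwo : TriangularBound 72 70 :=
  (((triangularBound_five.double (s := 9) (by norm_num)).double (s := 18) (by norm_num)).double
    (s := 36) (by norm_num)).half (l := 6) (by norm_num) (by norm_num)

theorem triangularBound_seventyFour : TriangularBound 74 72 :=
  (((triangularBound_five.double (s := 10) (by norm_num)).double (s := 19) (by norm_num)).double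
    (s := 37) (by norm_num)).half (l := 6) (by norm_num) (by norm_num)

/-- The depth bound for `n ≤ 2 ^ K`. -/
theorem exists_triangularBound {n K : ℕ} (hn : 0 < n) (hK : 5 ≤ K) (h : n ≤ 2 ^ K) :
    ∃ d, TriangularBound n d ∧
      ((2 * ((n - 1) / 2 + 1 + (2 * Nat.clog 2 n + 1)) + (6 + 2 * d) : ℕ) : ℤ) ≤
        2 * n + (2 * K ^ 2 + 7 * K - 25) := by
  obtain ⟨k, rfl⟩ : ∃ k, K = k + 5 := ⟨K - 5, by omega⟩
  obtain ⟨d, hd, ht⟩ := triangularBound_pow k n h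
  have hl : Nat.clog 2 n ≤ k + 5 := Nat.clog_le_of_le_pow h
  refine ⟨d, ht, ?_⟩
  generalize Nat.clog 2 n = l at *
  have hd' : (2 * d + 34 : ℤ) ≤ n + 2 * (k + 5) ^ 2 + 3 * (k + 5) := by exact_mod_cast hd
  have h1 : ((2 * ((n - 1) / 2 + 1 + (2 * l + 1)) + (6 + 2 * d) : ℕ) : ℤ) ≤
      n + 4 * (k + 5) + 9 + 2 * d := by omega
  push_cast at h1 ⊢
  linarith

/-- The general bound depends on `⌈log₂ n⌉`, and among the small `n` it is too weak at `43` and just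
above `64`; there the special triangular bounds take over. -/
theorem exists_depth_bound {n : ℕ} (hn : 43 ≤ n) :
    ∃ d, TriangularBound n d ∧
      ((2 * ((n - 1) / 2 + 1 + (2 * Nat.clog 2 n + 1)) + (6 + 2 * d) : ℕ) : ℤ) ≤
        ⌊2 * (n : ℝ) + 2.9487 * (Real.logb 2 n) ^ 2 + 8.4909 * Real.logb 2 n - 44.4798⌋ := by
  have hpow : ∀ m p : ℕ, 0 < m → ∀ a, a ≤ n → 2 ^ p ≤ a ^ m → (p / m : ℝ) ≤ Real.logb 2 n :=
    fun m p hm a ha h => div_le_logb_two hm (h.trans (Nat.pow_le_pow_left ha m))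
  rcases Nat.lt_or_ge n 44 with h44 | h44
  · obtain rfl : n = 43 := by omega
    have hl : Nat.clog 2 43 ≤ 6 := Nat.clog_le_of_le_pow (by norm_num)
    exact ⟨45, triangularBound_fortyThree, le_floor_of_le (e := 80) (q := 27 / 5) (by omega)
      (by norm_num) (by exact_mod_cast hpow 5 27 (by norm_num) 43 hn (by norm_num)) (by norm_num)⟩
  rcases Nat.lt_or_ge n 65 with h65 | h65
  · obtain ⟨d, hd, h⟩ := exists_triangularBound (n := n) (K := 6) (by omega) (by norm_num) (by omega)
    exact ⟨d, hd, le_floor_of_le h (q := 109 / 20) (by norm_num)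
      (by exact_mod_cast hpow 20 109 (by norm_num) 44 h44 (by norm_num)) (by norm_num)⟩
  -- With `K = 7` the general excess is `122`, which the claimed bound admits from `n = 75` on but
  -- not for `65 ≤ n ≤ 74`.
  rcases Nat.lt_or_ge n 75 with h75 | h75
  · have hl : Nat.clog 2 n ≤ 7 := Nat.clog_le_of_le_pow (by omega)
    have hq : (6 : ℝ) ≤ Real.logb 2 n := by
      have := hpow 1 6 (by norm_num) 65 h65 (by norm_num)
      norm_num at this
      exact this
    rcases Nat.lt_or_ge n 73 with h73 | h73
    · exact ⟨70, triangularBound_seventyTwo.mono (by omega) le_rfl,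
        le_floor_of_le (e := 112) (q := 6) (by omega) (by norm_num) hq (by norm_num)⟩
    · exact ⟨72, triangularBound_seventyFour.mono (by omega) le_rfl,
        le_floor_of_le (e := 108) (q := 6) (by omega) (by norm_num) hq (by norm_num)⟩
  rcases Nat.lt_or_ge n 129 with h129 | h129
  · obtain ⟨d, hd, h⟩ := exists_triangularBound (n := n) (K := 7) (by omega) (by norm_num) (by omega)
    exact ⟨d, hd, le_floor_of_le h (q := 56 / 9) (by norm_num)
      (by exact_mod_cast hpow 9 56 (by norm_num) 75 h75 (by norm_num)) (by norm_num)⟩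
  · have hK : 8 ≤ Nat.clog 2 n := by
      have : 7 < Nat.clog 2 n := (Nat.lt_clog_iff_pow_lt one_lt_two).2 (by omega)
      omega
    obtain ⟨t, ht⟩ : ∃ t, Nat.clog 2 n = t + 1 := ⟨Nat.clog 2 n - 1, by omega⟩
    obtain ⟨d, hd, h⟩ := exists_triangularBound (n := n) (K := t + 1) (by omega) (by omega)
      (ht ▸ Nat.le_pow_clog one_lt_two n)
    have hpt : 2 ^ t < n := (Nat.lt_clog_iff_pow_lt one_lt_two).1 (by omega)
    have h7 : (7 : ℝ) ≤ t := by
      have : 7 ≤ t := by omega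
      exact_mod_cast this
    refine ⟨d, hd, le_floor_of_le h (q := t) (by positivity) ?_ ?_⟩
    · have := div_le_logb_two (n := n) (p := t) (m := 1) (by norm_num) (by simpa using hpt.le)
      simpa using this
    -- With `t < log₂ n ≤ t + 1` it remains that `2(t+1)² + 7(t+1) - 25` is at most the claimed
    -- expression at `t`; this holds from `t = 7` on and fails at `t = 6`.
    · push_cast
      nlinarith

end CliffordDepth

theorem mainTheorem3 (n : ℕ) (hn : 43 ≤ n) (hn' : n ≤ 1345000)
    (U : Matrix (CliffordDepth.Basis n) (CliffordDepth.Basis n) ℂ)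
    (hU : CliffordDepth.IsClifford U) :
    ∃ c : CliffordDepth.Circuit n, CliffordDepth.Circuit.toMatrix c = U ∧
      (CliffordDepth.Circuit.depth c : ℤ) ≤
        ⌊2 * (n : ℝ) + 2.9487 * (Real.logb 2 n) ^ 2 + 8.4909 * Real.logb 2 n - 44.4798⌋ := by
  obtain ⟨c, -, rfl⟩ := hU
  obtain ⟨d, hd, hbound⟩ := CliffordDepth.exists_depth_bound hn
  obtain ⟨c', hc', hdepth⟩ :=
    (CliffordDepth.impl_clifford (by omega) hd c).depth_le
  exact ⟨c', hc', le_trans (by exact_mod_cast hdepth) hbound⟩
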